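/- Let $d,d'\ge 1$ be integers, $D=d+d'$, and let $0<p<\infty$, $0<q\le\infty$, $d/p<s<\infty$. Let $\Psi^0$ (scaling function) and $\Psi^1$ (mother wavelet) be an $N$-regular pair with $N\ge\lfloor s\rfloor+1$: both are compactly supported and of class $C^N$ on $\mathbb R$; $\int_{\mathbb R} x^n\Psi^1(x)\,dx=0$ for $0\le n\le N$; the functions $\Psi^1(2^jx-k)$, $j,k\in\mathbb Z$, form an orthogonal basis of $L^2(\mathbb R)$; and so do the functions $\Psi^0(x-k)$, $k\in\mathbb Z$, together with $\Psi^1(2^jx-k)$, $j\ge 0$, $k\in\mathbb Z$. For $j\ge1$, $k\in\{0,\dots,2^j-1\}^D$ and $l\in\{0,1\}^D\setminus\{0\}$ put $\Psi_{j,k,l}(y)=\prod_{i=1}^D\Psi^{l_i}(2^jy_i-k_i)$. Let $B^s_{p,q}([0,1]^D)$ be the space of wavelet series $f=\sum_{j\ge 1}\sum_{k,l}c_{j,k,l}\Psi_{j,k,l}$ with finite (quasi-)norm $$\|f\|=\Big(\sum_{j\ge1}\Big(2^{(sp-D)j}\sum_{k,l}|c_{j,k,l}|^p\Big)^{q/p}\Big)^{1/q}$$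 (a supremum over $j$ if $q=\infty$), with the topology of this (quasi-)norm; $f$ is identified with its family of coefficients. For $a\in[0,1]^{d'}$ the trace $f_a:\mathbb R^d\to\mathbb R$ is $$f_a(x)=\lim_{J\to\infty}\sum_{j=1}^{J}\sum_{k,l}c_{j,k,l}\Psi_{j,k,l}(x,a),$$ and it is said to exist if this limit is uniform in $x\in\mathbb R^d$. For a function $g$ on $[0,1]^d$ and $x_0\in[0,1]^d$, let $h_g(x_0)\in[0,\infty]$ be the supremum of all $\alpha\ge0$ for which there are a polynomial $P$ of degree at most $\lfloor\alpha\rfloor$ and a constant $C>0$ with $|g(x)-P(x-x_0)|\le C|x-x_0|^\alpha$ for all $x\in[0,1]^d$ in a neighbourhood of $x_0$. A subset of a topological vector space $E$ is shy if it is contained in a universally measurable set $B$ for which there is a Borel measure $\mu$ on $E$, with $0<\mu(K)<\infty$ for some compact $K\subset E$, such that $\mu(B+x)=0$ for every $x\in E$; it is prevalent if its complement is shy. Then the set of those $f\in B^s_{p,q}([0,1]^D)$ such that, for Lebesgue-almost every $a\in[0,1]^{d'}$, the trace $f_a$ exists and $h_{f_a}(x)\le s$ for every $x\in[0,1]^d$,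 is prevalent in $B^s_{p,q}([0,1]^D)$. -/

import Mathlib

open MeasureTheory Filter Topology
open scoped ENNReal NNReal

noncomputable section

/-! ### Wavelets -/

/-- The functions `e i` form an orthogonal (not necessarily normalized) basis of `L²(ℝ)`:
nonzero, pairwise orthogonal, and only the zero class is orthogonal to all of them. -/
structure IsOrthogonalBasisL2 {ι : Type} (e : ι → ℝ → ℝ) : Prop where
  memLp : ∀ i, MemLp (e i) 2 volume
  ne_zero : ∀ i, ¬ (e i =ᵐ[volume] 0)
  orthogonal : ∀ i i', i ≠ i' → ∫ x, e i x * e i' x = 0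
  complete : ∀ g : ℝ → ℝ, MemLp g 2 volume → (∀ i, ∫ x, g x * e i x = 0) → g =ᵐ[volume] 0

/-- The `N`-regular compactly supported wavelets of a multiresolution analysis: `Ψ 0` is the
scaling function and `Ψ 1` the mother wavelet. The dilates and translates of `Ψ 1` form an
orthogonal basis of `L²(ℝ)`; so do the translates of `Ψ 0` together with those `Ψ 1 (2 ^ j x - k)`
with `j ≥ 0`, which says that the translates of `Ψ 0` form an orthogonal basis of
the space `V₀` spanned by the wavelets of scale `j < 0`. -/
structure IsRegularWavelet (N : ℕ) (Ψ : Fin 2 → ℝ → ℝ) : Prop where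
  contDiff : ∀ l, ContDiff ℝ N (Ψ l)
  hasCompactSupport : ∀ l, HasCompactSupport (Ψ l)
  vanishing_moments : ∀ n ≤ N, ∫ x, x ^ n * Ψ 1 x = 0
  basis : IsOrthogonalBasisL2 (fun (jk : ℤ × ℤ) x => Ψ 1 ((2 : ℝ) ^ jk.1 * x - jk.2))
  scaling : IsOrthogonalBasisL2
    (Sum.elim (fun (k : ℤ) x => Ψ 0 (x - k))
      (fun (jk : ℕ × ℤ) x => Ψ 1 ((2 : ℝ) ^ jk.1 * x - jk.2)))

/-- Families of wavelet coefficients on `[0,1]^D`. The number `c n k l` is the coefficient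
`c_{(j,k,l)}` of scale `j = n + 1 ≥ 1`, position `k ∈ {0, …, 2 ^ j - 1} ^ D` and type
`l ∈ {0,1} ^ D \ {0}`. -/
abbrev WaveletCoeff (D : ℕ) : Type :=
  (n : ℕ) → (Fin D → Fin (2 ^ (n + 1))) → {l : Fin D → Fin 2 // l ≠ 0} → ℝ

/-- The tensor product wavelet
`Ψ_{(j,k,l)}(x) = ∏ i, Ψ^{l_i}(2 ^ j x_i - k_i)`. -/
def tensorWavelet {D : ℕ} (Ψ : Fin 2 → ℝ → ℝ) (j : ℕ) (k : Fin D → Fin (2 ^ j))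
    (l : Fin D → Fin 2) (x : Fin D → ℝ) : ℝ :=
  ∏ i, Ψ (l i) (2 ^ j * x i - ((k i : ℕ) : ℝ))

/-- The sum of all terms `c_λ Ψ_λ(x)` of scale `1 ≤ j ≤ J` of the wavelet series. -/
def waveletPartialSum {D : ℕ} (Ψ : Fin 2 → ℝ → ℝ) (c : WaveletCoeff D) (J : ℕ)
    (x : Fin D → ℝ) : ℝ :=
  ∑ n ∈ Finset.range J, ∑ k, ∑ l, c n k l * tensorWavelet Ψ (n + 1) k l.1 x

/-- `g` is the trace `x ↦ f(x, a)` of `f = ∑ c_λ Ψ_λ`: the partial sums of the wavelet series,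
restricted to the affine subspace `{(x, a)}`, converge uniformly to `g`. -/
def IsTrace {d d' : ℕ} (Ψ : Fin 2 → ℝ → ℝ) (c : WaveletCoeff (d + d')) (a : Fin d' → ℝ)
    (g : (Fin d → ℝ) → ℝ) : Prop :=
  TendstoUniformly (fun (J : ℕ) (x : Fin d → ℝ) => waveletPartialSum Ψ c J (Fin.append x a))
    g atTop

/-! ### Besov spaces -/

/-- `2 ^ (j (s - D / p)) (∑_{k,l} |c_{(j,k,l)}| ^ p) ^ (1 / p)` with `j = n + 1`. -/
def besovBlock {D : ℕ} (s p : ℝ) (c : WaveletCoeff D) (n : ℕ) : ℝ≥0∞ :=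
  (2 : ℝ≥0∞) ^ ((s - D / p) * ((n : ℝ) + 1)) * (∑ k, ∑ l, ‖c n k l‖ₑ ^ p) ^ (1 / p)

/-- The Besov (quasi-)norm in terms of wavelet coefficients. -/
def besovNorm {D : ℕ} (s p : ℝ) (q : ℝ≥0∞) (c : WaveletCoeff D) : ℝ≥0∞ :=
  if q = ∞ then ⨆ n, besovBlock s p c n
  else (∑' n, besovBlock s p c n ^ q.toReal) ^ (1 / q.toReal)

lemma add_rpow_le_two_rpow (a b : ℝ≥0∞) {r : ℝ} (hr : 0 ≤ r) :
    (a + b) ^ r ≤ 2 ^ r * (a ^ r + b ^ r) := by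
  rcases le_total a b with h | h
  · calc (a + b) ^ r ≤ (2 * b) ^ r := by
          apply ENNReal.rpow_le_rpow _ hr
          rw [two_mul]; gcongr
      _ = 2 ^ r * b ^ r := ENNReal.mul_rpow_of_nonneg _ _ hr
      _ ≤ _ := by gcongr; exact le_add_self
  · calc (a + b) ^ r ≤ (2 * a) ^ r := by
          apply ENNReal.rpow_le_rpow _ hr
          rw [two_mul]; gcongr
      _ = 2 ^ r * a ^ r := ENNReal.mul_rpow_of_nonneg _ _ hr
      _ ≤ _ := by gcongr; exact le_self_add

lemma besovBlock_add_le {D : ℕ} {s p : ℝ} (hp : 0 < p) (c c' : WaveletCoeff D) (n : ℕ) :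
    besovBlock s p (c + c') n ≤
      (2 * 2 ^ (1 / p)) * (besovBlock s p c n + besovBlock s p c' n) := by
  have h1 : (∑ k, ∑ l, ‖(c + c') n k l‖ₑ ^ p) ≤
      2 ^ p * ((∑ k, ∑ l, ‖c n k l‖ₑ ^ p) + ∑ k, ∑ l, ‖c' n k l‖ₑ ^ p) := by
    rw [← Finset.sum_add_distrib, Finset.mul_sum]
    refine Finset.sum_le_sum fun k _ => ?_
    rw [← Finset.sum_add_distrib, Finset.mul_sum]
    refine Finset.sum_le_sum fun l _ => ?_
    exact (ENNReal.rpow_le_rpow (enorm_add_le _ _) hp.le).trans (add_rpow_le_two_rpow _ _ hp.le)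
  have h2 := ENNReal.rpow_le_rpow h1 (z := 1 / p) (by positivity)
  rw [ENNReal.mul_rpow_of_nonneg _ _ (by positivity), ← ENNReal.rpow_mul,
    mul_one_div_cancel hp.ne', ENNReal.rpow_one] at h2
  have h3 := h2.trans (mul_le_mul_right (add_rpow_le_two_rpow _ _ (by positivity : 0 ≤ 1 / p)) 2)
  unfold besovBlock
  refine (mul_le_mul_right h3 _).trans (le_of_eq ?_)
  ring

lemma besovBlock_smul {D : ℕ} {s p : ℝ} (hp : 0 < p) (r : ℝ) (c : WaveletCoeff D) (n : ℕ) :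
    besovBlock s p (r • c) n = ‖r‖ₑ * besovBlock s p c n := by
  have h : ∀ k l, ‖(r • c) n k l‖ₑ ^ p = ‖r‖ₑ ^ p * ‖c n k l‖ₑ ^ p := fun k l => by
    rw [← ENNReal.mul_rpow_of_nonneg _ _ hp.le, ← enorm_mul]; rfl
  unfold besovBlock
  simp_rw [h, ← Finset.mul_sum]
  rw [ENNReal.mul_rpow_of_nonneg _ _ (by positivity), ← ENNReal.rpow_mul,
    mul_one_div_cancel hp.ne', ENNReal.rpow_one]
  ring

lemma besovNorm_lt_top_iff {D : ℕ} {s p : ℝ} {q : ℝ≥0∞} (hq : 0 < q) (c : WaveletCoeff D) :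
    besovNorm s p q c < ∞ ↔
      if q = ∞ then ⨆ n, besovBlock s p c n < ∞
      else ∑' n, besovBlock s p c n ^ q.toReal < ∞ := by
  unfold besovNorm
  split_ifs with h
  · rfl
  · have := ENNReal.toReal_pos hq.ne' h
    rw [ENNReal.rpow_lt_top_iff_of_pos (by positivity)]

/-- The wavelet coefficients of the elements of `B^s_{p,q}([0,1]^D)`. -/
def besovSubmodule (D : ℕ) (s p : ℝ) (q : ℝ≥0∞) (hp : 0 < p) (hq : 0 < q) :
    Submodule ℝ (WaveletCoeff D) where
  carrier := {c | besovNorm s p q c < ∞}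
  zero_mem' := by
    have h : ∀ n, besovBlock s p (0 : WaveletCoeff D) n = 0 := fun n => by
      simpa using besovBlock_smul (s := s) hp 0 (0 : WaveletCoeff D) n
    rw [Set.mem_ofPred_eq, besovNorm_lt_top_iff hq]
    split_ifs with hq'
    · simp [h]
    · simp [h, ENNReal.toReal_pos hq.ne' hq']
  add_mem' := by
    intro c c' hc hc'
    rw [Set.mem_ofPred_eq, besovNorm_lt_top_iff hq] at hc hc' ⊢
    have hK : (2 * 2 ^ (1 / p) : ℝ≥0∞) < ∞ :=
      ENNReal.mul_lt_top (by simp) (ENNReal.rpow_lt_top_of_nonneg (by positivity) (by simp))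
    split_ifs at hc hc' ⊢ with h
    · refine lt_of_le_of_lt (iSup_le fun n => (besovBlock_add_le hp c c' n).trans ?_)
        (ENNReal.mul_lt_top hK (ENNReal.add_lt_top.2 ⟨hc, hc'⟩))
      gcongr
      · exact le_iSup (fun n => besovBlock s p c n) n
      · exact le_iSup (fun n => besovBlock s p c' n) n
    · have hr := ENNReal.toReal_pos hq.ne' h
      have hb : ∀ n, besovBlock s p (c + c') n ^ q.toReal ≤
          ((2 * 2 ^ (1 / p)) ^ q.toReal * 2 ^ q.toReal) *
            (besovBlock s p c n ^ q.toReal + besovBlock s p c' n ^ q.toReal) := fun n => by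
        refine (ENNReal.rpow_le_rpow (besovBlock_add_le hp c c' n) hr.le).trans ?_
        rw [ENNReal.mul_rpow_of_nonneg _ _ hr.le, mul_assoc]
        gcongr
        exact add_rpow_le_two_rpow _ _ hr.le
      refine lt_of_le_of_lt (ENNReal.tsum_le_tsum hb) ?_
      rw [ENNReal.tsum_mul_left, ENNReal.tsum_add]
      exact ENNReal.mul_lt_top
        (ENNReal.mul_lt_top (ENNReal.rpow_lt_top_of_nonneg hr.le hK.ne)
          (ENNReal.rpow_lt_top_of_nonneg hr.le (by simp)))
        (ENNReal.add_lt_top.2 ⟨hc, hc'⟩)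
  smul_mem' := by
    intro r c hc
    rw [Set.mem_ofPred_eq, besovNorm_lt_top_iff hq] at hc ⊢
    split_ifs at hc ⊢ with h
    · simp_rw [besovBlock_smul hp, ← ENNReal.mul_iSup]
      exact ENNReal.mul_lt_top enorm_lt_top hc
    · have hr := ENNReal.toReal_pos hq.ne' h
      simp_rw [besovBlock_smul hp, ENNReal.mul_rpow_of_nonneg _ _ hr.le]
      rw [ENNReal.tsum_mul_left]
      exact ENNReal.mul_lt_top (ENNReal.rpow_lt_top_of_nonneg hr.le enorm_ne_top) hc

/-- The Besov space `B^s_{p,q}([0,1]^D)` of all wavelet series `f = ∑ c_λ Ψ_λ` with finite Besov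
(quasi-)norm. An element is given by its coefficients, which determine `f` and are determined
by it. -/
def BesovSpace (D : ℕ) (s p : ℝ) (q : ℝ≥0∞) (hp : 0 < p) (hq : 0 < q) : Type :=
  besovSubmodule D s p q hp hq

namespace BesovSpace

variable {D : ℕ} {s p : ℝ} {q : ℝ≥0∞} {hp : 0 < p} {hq : 0 < q}

instance : AddCommGroup (BesovSpace D s p q hp hq) :=
  inferInstanceAs (AddCommGroup (besovSubmodule D s p q hp hq))

instance : Module ℝ (BesovSpace D s p q hp hq) :=
  inferInstanceAs (Module ℝ (besovSubmodule D s p q hp hq))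

/-- The wavelet coefficients of an element of the Besov space. -/
def coeff (f : BesovSpace D s p q hp hq) : WaveletCoeff D := f.1

/-- The topology of the Besov (quasi-)norm: `U` is open if it contains, with each of its points,
a ball around that point. -/
instance : TopologicalSpace (BesovSpace D s p q hp hq) where
  IsOpen U := ∀ f ∈ U, ∃ ε : ℝ, 0 < ε ∧
    ∀ g, besovNorm s p q (coeff (g - f)) < ENNReal.ofReal ε → g ∈ U
  isOpen_univ := fun _ _ => ⟨1, one_pos, fun _ _ => trivial⟩
  isOpen_inter := by
    intro U V hU hV f hf
    obtain ⟨ε, hε, h⟩ := hU f hf.1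
    obtain ⟨δ, hδ, h'⟩ := hV f hf.2
    exact ⟨min ε δ, lt_min hε hδ, fun g hg =>
      ⟨h g (hg.trans_le (ENNReal.ofReal_le_ofReal (min_le_left _ _))),
        h' g (hg.trans_le (ENNReal.ofReal_le_ofReal (min_le_right _ _)))⟩⟩
  isOpen_sUnion := by
    intro S hS f hf
    obtain ⟨U, hU, hfU⟩ := hf
    obtain ⟨ε, hε, h⟩ := hS U hU f hfU
    exact ⟨ε, hε, fun g hg => ⟨U, hU, h g hg⟩⟩

instance : MeasurableSpace (BesovSpace D s p q hp hq) := borel _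

instance : BorelSpace (BesovSpace D s p q hp hq) := ⟨rfl⟩

end BesovSpace

/-! ### Prevalence -/

/-- Measurable for the completion of every finite Borel measure. -/
def IsUniversallyMeasurable {E : Type} [MeasurableSpace E] (A : Set E) : Prop :=
  ∀ μ : Measure E, IsFiniteMeasure μ → NullMeasurableSet A μ

/-- A set is shy if it is contained in a universally measurable set all of whose translates are
null for one Borel measure `μ` which is positive and finite on some compact set. -/
def IsShy {E : Type} [AddCommGroup E] [TopologicalSpace E] [MeasurableSpace E] [BorelSpace E]
    (A : Set E) : Prop :=
  ∃ B : Set E, A ⊆ B ∧ IsUniversallyMeasurable B ∧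
    ∃ μ : Measure E, (∃ K : Set E, IsCompact K ∧ 0 < μ K ∧ μ K < ∞) ∧
      ∀ x : E, μ ((fun y => y + x) '' B) = 0

/-- A set is prevalent if its complement is shy. -/
def IsPrevalent {E : Type} [AddCommGroup E] [TopologicalSpace E] [MeasurableSpace E]
    [BorelSpace E] (A : Set E) : Prop :=
  IsShy Aᶜ

/-! ### Pointwise regularity -/

/-- `f`, regarded as a function on `S`, belongs to `C^α(x₀)`. -/
def PointwiseHolderWithin {d : ℕ} (α : ℝ≥0) (f : (Fin d → ℝ) → ℝ) (S : Set (Fin d → ℝ))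
    (x₀ : Fin d → ℝ) : Prop :=
  ∃ P : MvPolynomial (Fin d) ℝ, P.totalDegree ≤ ⌊α⌋₊ ∧ ∃ C : ℝ, 0 < C ∧
    ∀ᶠ x in 𝓝[S] x₀, |f x - MvPolynomial.eval (x - x₀) P| ≤ C * ‖x - x₀‖ ^ (α : ℝ)

/-- The pointwise Hölder exponent at `x₀` of `f`, regarded as a function on `S`. For `x₀` in the
interior of `S` it does not depend on `S`; otherwise it is at least the exponent for the whole
space. -/
def holderExponentWithin {d : ℕ} (f : (Fin d → ℝ) → ℝ) (S : Set (Fin d → ℝ))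
    (x₀ : Fin d → ℝ) : ℝ≥0∞ :=
  ⨆ (α : ℝ≥0) (_ : PointwiseHolderWithin α f S x₀), (α : ℝ≥0∞)

end

/-! ### Small ball estimates under the product measure -/

/-! The probe is the law of a random wavelet series whose coefficients of scale j are independent
and uniform on [0, 2^(-sj) / j^γ]. For γ large the series lies in the Besov space and depends
continuously on a point of a compact cube (`exists_probe_continuous`). By Fubini it suffices to fix
f and almost every a, and to show that almost surely the trace at a of f plus the random series has
no point of exponent larger than s.

Suppose the exponent at x₀ exceeds s. For some m, differences of order m + 1 kill the approximating
polynomial, so at every large scale j all those taken in a dyadic block around x₀ are at most 2^(-(s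
+ 1/(m+1)) j) (`isFlatTrace_of_pointwiseHolderWithin`). In each block (m+1)(d+1) differences are
tested, with nodes so far apart that each one sees one private random coefficient of scale j. If the
wavelet factor in a is at least τ^d', that coefficient enters with weight of order 2^(-sj) / j^γ, so
each difference is small with probability at most C j^γ 2^(-j/(m+1)), and the bounds multiply
(`infinitePi_abs_add_sum_le`). The product is a power of j times 2^(-(d+1)j), which beats the 2^(dj)
possible blocks (`probeLaw_isFlatTrace_eq_zero`). The lower bound on the factor in a is needed at
infinitely many scales only, and almost every a provides this by Lebesgue density
(`ae_frequently_mem_dyadicHitSet`).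

Existence of the trace holds for every f at almost every a. A wavelet of scale j meets the slice at
a only for a in a set of measure of order 2^(-d'j), so on average over a the coefficients that
matter obey a Besov bound with d in place of D, and s > d/p makes them decay geometrically
(`ae_exists_isTrace`). -/

lemma volume_unitInterval_abs_add_mul_le (b : ℝ) {θ A ε : ℝ} (hA : 0 < A) (hθ : A ≤ |θ|)
    (hε : 0 ≤ ε) :
    volume {x : unitInterval | |b + θ * x| ≤ ε} ≤ ENNReal.ofReal (2 * ε / A) := by
  have hθ0 : θ ≠ 0 := by
    rintro rfl; simp at hθ; linarith
  have hsub : {x : unitInterval | |b + θ * x| ≤ ε} ⊆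
      ((↑) : unitInterval → ℝ) ⁻¹' Metric.closedBall (-b / θ) (ε / A) := by
    intro x hx
    simp only [Set.mem_ofPred_eq, Set.mem_preimage, Metric.mem_closedBall, Real.dist_eq] at hx ⊢
    have h1 : (x : ℝ) - -b / θ = (b + θ * x) / θ := by field_simp; ring
    rw [h1, abs_div]
    exact div_le_div₀ hε hx hA hθ
  refine (measure_mono hsub).trans ?_
  rw [volume_set_coe_def, comap_subtype_coe_apply measurableSet_Icc]
  refine (measure_mono (Set.image_preimage_subset _ _)).trans ?_
  rw [Real.volume_closedBall, mul_div_assoc]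

/-- Freeze all coordinates outside the range of `idx`: they only shift the constants `b t`. By
`hoff` the remaining system is diagonal, so each slice is a box whose M sides are bounded by the
one-variable estimate. -/
lemma infinitePi_abs_add_sum_le {Λ : Type} (F : Finset Λ) {M : ℕ} (idx : Fin M → Λ)
    (hidx : Function.Injective idx) (hF : ∀ t, idx t ∈ F) (b : Fin M → ℝ)
    (θ : Fin M → Λ → ℝ) (hoff : ∀ t t', t ≠ t' → θ t (idx t') = 0) {A ε : ℝ} (hA : 0 < A)
    (hε : 0 ≤ ε) (hdiag : ∀ t, A ≤ |θ t (idx t)|) :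
    Measure.infinitePi (fun _ : Λ => (volume : Measure unitInterval))
      {ω | ∀ t, |b t + ∑ i ∈ F, θ t i * (ω i : ℝ)| ≤ ε} ≤ ENNReal.ofReal (2 * ε / A) ^ M := by
  classical
  set P := Measure.infinitePi (fun _ : Λ => (volume : Measure unitInterval)) with hP
  set S : Finset Λ := Finset.univ.image idx with hS
  set T := F \ S with hT
  have hind : ProbabilityTheory.iIndepFun (fun (i : Λ) (ω : Λ → unitInterval) => ω i) P :=
    ProbabilityTheory.iIndepFun_infinitePi (X := fun _ x => x) (fun _ => measurable_id)
  have h1 := hind.indepFun_finset S T Finset.disjoint_sdiff (fun i => measurable_pi_apply i)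
  have hmem : ∀ t, idx t ∈ S := fun t => by simp [hS]
  have h2 : ProbabilityTheory.IndepFun (fun (ω : Λ → unitInterval) (t : Fin M) => ω (idx t))
      (fun (ω : Λ → unitInterval) (i : T) => ω i) P :=
    h1.comp (φ := fun (u : S → unitInterval) (t : Fin M) => u ⟨idx t, hmem t⟩)
      (ψ := id) (by fun_prop) measurable_id
  have h3 := (ProbabilityTheory.indepFun_iff_map_prod_eq_prod_map_map
    (Measurable.aemeasurable (by fun_prop)) (Measurable.aemeasurable (by fun_prop))).1 h2
  have h4 : P.map (fun (ω : Λ → unitInterval) (t : Fin M) => ω (idx t)) =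
      Measure.pi (fun _ => volume) := by
    rw [← Measure.infinitePi_eq_pi]
    exact Measure.map_infinitePi_infinitePi_of_inj hidx (P := fun _ : Λ => volume)
  have hsum : ∀ (ω : Λ → unitInterval) (t : Fin M), ∑ i ∈ F, θ t i * (ω i : ℝ) =
      θ t (idx t) * ω (idx t) + ∑ i : T, θ t i * (ω i : ℝ) := by
    intro ω t
    have hSF : S ⊆ F := by
      intro i hi
      obtain ⟨t, -, rfl⟩ := Finset.mem_image.1 hi
      exact hF t
    rw [← Finset.sum_sdiff hSF, add_comm, Finset.sum_image (fun _ _ _ _ h => hidx h),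
      Finset.sum_eq_single t, Finset.sum_coe_sort T (fun i => θ t i * (ω i : ℝ))]
    · intro t' _ h
      rw [hoff t t' h.symm, zero_mul]
    · simp
  set E : Set ((Fin M → unitInterval) × (T → unitInterval)) :=
    {z | ∀ t, |b t + (θ t (idx t) * z.1 t + ∑ i : T, θ t i * (z.2 i : ℝ))| ≤ ε} with hE
  have hEm : MeasurableSet E := by
    rw [hE, Set.ofPred_forall]
    refine MeasurableSet.iInter fun t => measurableSet_le ?_ measurable_const
    fun_prop
  have hpre : {ω : Λ → unitInterval | ∀ t, |b t + ∑ i ∈ F, θ t i * (ω i : ℝ)| ≤ ε} =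
      (fun ω => ((fun t => ω (idx t)), (fun i : T => ω i))) ⁻¹' E := by
    ext ω
    simp [hE, hsum]
  rw [hpre, ← Measure.map_apply (by fun_prop) hEm, h3, h4,
    Measure.prod_apply_symm hEm]
  have hb : ∀ y : T → unitInterval, Measure.pi (fun _ : Fin M => (volume : Measure unitInterval))
      ((fun x => (x, y)) ⁻¹' E) ≤ ENNReal.ofReal (2 * ε / A) ^ M := by
    intro y
    have : (fun x => (x, y)) ⁻¹' E = Set.pi Set.univ (fun t => {x : unitInterval |
        |(b t + ∑ i : T, θ t i * (y i : ℝ)) + θ t (idx t) * x| ≤ ε}) := by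
      ext x
      simp only [hE, Set.mem_preimage, Set.mem_ofPred_eq, Set.mem_pi, Set.mem_univ, true_imp_iff]
      refine forall_congr' fun t => ?_
      rw [add_assoc, add_comm (∑ i : T, _)]
    rw [this, Measure.pi_pi]
    refine (Finset.prod_le_prod' fun t _ =>
      volume_unitInterval_abs_add_mul_le _ hA (hdiag t) hε).trans ?_
    simp
  refine (lintegral_mono hb).trans ?_
  have : IsProbabilityMeasure (P.map (fun (ω : Λ → unitInterval) (i : T) => ω i)) :=
    Measure.isProbabilityMeasure_map (Measurable.aemeasurable (by fun_prop))
  simp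

/-! ### Finite differences -/

/-- The `n`-th finite difference of `g` at `y` with step `h`. -/
def finiteDiff {d : ℕ} (n : ℕ) (h y : Fin d → ℝ) (g : (Fin d → ℝ) → ℝ) : ℝ :=
  ∑ i ∈ Finset.range (n + 1), ((-1) ^ (n - i) * (n.choose i : ℝ)) * g (y + (i : ℝ) • h)

/-- Along the line y + t h the polynomial becomes a univariate one of degree less than n, which the
n-th forward difference annihilates. -/
lemma finiteDiff_polynomial {d : ℕ} {n : ℕ} (h y x₀ : Fin d → ℝ) (P : MvPolynomial (Fin d) ℝ)
    (hP : P.totalDegree < n) :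
    finiteDiff n h y (fun x => MvPolynomial.eval (x - x₀) P) = 0 := by
  set Q : Polynomial ℝ := MvPolynomial.aeval
    (fun i => Polynomial.C (y i - x₀ i) + Polynomial.X * Polynomial.C (h i)) P with hQ
  have hdeg : Q.natDegree < n := by
    refine lt_of_le_of_lt (MvPolynomial.aeval_natDegree_le P le_rfl _ (n := 1) fun i => ?_)
      (by simpa using hP)
    compute_degree
  have hev : ∀ t : ℝ, Q.eval t = MvPolynomial.eval (y + t • h - x₀) P := by
    intro t
    rw [hQ, ← Polynomial.coe_evalRingHom, MvPolynomial.aeval_def, MvPolynomial.hom_eval₂,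
      MvPolynomial.eval, MvPolynomial.coe_eval₂Hom]
    congr 1
    · ext x; simp
    · ext i
      simp only [Polynomial.coe_evalRingHom, Polynomial.eval_add, Polynomial.eval_C,
        Polynomial.eval_mul, Polynomial.eval_X, Pi.sub_apply, Pi.add_apply, Pi.smul_apply,
        smul_eq_mul]
      ring
  have hz := congrFun (Polynomial.fwdDiff_iter_eq_zero_of_degree_lt hdeg) 0
  rw [fwdDiff_iter_eq_sum_shift] at hz
  simp only [nsmul_eq_mul, mul_one, zero_add, hev, Pi.zero_apply, zsmul_eq_mul] at hz
  rw [finiteDiff, ← hz]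
  refine Finset.sum_congr rfl fun i _ => ?_
  push_cast
  ring

lemma finiteDiff_add {d : ℕ} (n : ℕ) (h y : Fin d → ℝ) (g g' : (Fin d → ℝ) → ℝ) :
    finiteDiff n h y (fun x => g x + g' x) = finiteDiff n h y g + finiteDiff n h y g' := by
  simp only [finiteDiff, mul_add, Finset.sum_add_distrib]

lemma finiteDiff_sum {d : ℕ} {ι : Type*} (n : ℕ) (h y : Fin d → ℝ) (F : Finset ι)
    (c : ι → ℝ) (g : ι → (Fin d → ℝ) → ℝ) :
    finiteDiff n h y (fun x => ∑ i ∈ F, c i * g i x) = ∑ i ∈ F, c i * finiteDiff n h y (g i) := by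
  simp only [finiteDiff, Finset.mul_sum]
  rw [Finset.sum_comm]
  refine Finset.sum_congr rfl fun i _ => Finset.sum_congr rfl fun j _ => ?_
  ring

lemma abs_finiteDiff_le {d : ℕ} (n : ℕ) (h y : Fin d → ℝ) (g : (Fin d → ℝ) → ℝ) {B : ℝ}
    (hB : ∀ i ≤ n, |g (y + (i : ℝ) • h)| ≤ B) : |finiteDiff n h y g| ≤ 2 ^ n * B := by
  calc |finiteDiff n h y g| ≤ ∑ i ∈ Finset.range (n + 1), (n.choose i : ℝ) * B := by
        refine (Finset.abs_sum_le_sum_abs _ _).trans (Finset.sum_le_sum fun i hi => ?_)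
        rw [abs_mul, abs_mul, abs_pow, abs_neg, abs_one, one_pow, one_mul, Nat.abs_cast]
        gcongr
        exact hB i (by simpa [Nat.lt_succ_iff] using hi)
    _ = 2 ^ n * B := by
        rw [← Finset.sum_mul]
        congr 1
        exact_mod_cast Nat.sum_range_choose n

lemma tendsto_finiteDiff {d : ℕ} (n : ℕ) (h y : Fin d → ℝ) {G : ℕ → (Fin d → ℝ) → ℝ}
    {g : (Fin d → ℝ) → ℝ} (hG : TendstoUniformly G g atTop) :
    Tendsto (fun J => finiteDiff n h y (G J)) atTop (𝓝 (finiteDiff n h y g)) :=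
  tendsto_finsetSum _ fun _ _ => (hG.tendsto_at _).const_mul _

/-! ### Recurrence of dyadic dilations -/

/-- The points all of whose coordinates are sent by one of the maps `y ↦ 2 ^ j y - k` into the
set where `|ψ| ≥ c`. -/
def dyadicHitSet {d' : ℕ} (ψ : ℝ → ℝ) (c : ℝ) (j : ℕ) : Set (Fin d' → ℝ) :=
  {a | ∃ k : Fin d' → Fin (2 ^ j), ∀ i, c ≤ |ψ (2 ^ j * a i - ((k i : ℕ) : ℝ))|}

lemma measurableSet_dyadicHitSet {d' : ℕ} {ψ : ℝ → ℝ} (hψ : Continuous ψ) (c : ℝ) (j : ℕ) :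
    MeasurableSet (dyadicHitSet (d' := d') ψ c j) := by
  have : dyadicHitSet (d' := d') ψ c j = ⋃ k : Fin d' → Fin (2 ^ j), ⋂ i,
      {a | c ≤ |ψ (2 ^ j * a i - ((k i : ℕ) : ℝ))|} := by
    ext a; simp [dyadicHitSet]
  rw [this]
  refine MeasurableSet.iUnion fun k => MeasurableSet.iInter fun i => ?_
  exact measurableSet_le measurable_const (Continuous.measurable (by fun_prop))

/-- A coordinate `y ∈ [0,1]` is within distance `L` to the right of a dyadic integer that leaves
room for a block of length `L`. -/
lemma exists_dyadic_block {j L : ℕ} (hL : 1 ≤ L) (hj : L ≤ 2 ^ j) {y : ℝ} (hy0 : 0 ≤ y)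
    (hy1 : y ≤ 1) :
    ∃ k : Fin (2 ^ j), (k : ℕ) + L ≤ 2 ^ j ∧ ((k : ℕ) : ℝ) ≤ 2 ^ j * y ∧
      2 ^ j * y ≤ ((k : ℕ) : ℝ) + L := by
  have hpos : (0 : ℝ) ≤ 2 ^ j * y := by positivity
  have hfl := Nat.floor_le hpos
  have hfl' := Nat.lt_floor_add_one (2 ^ j * y)
  have hle : (2 : ℝ) ^ j * y ≤ 2 ^ j := by
    have : (0 : ℝ) < 2 ^ j := by positivity
    nlinarith
  have hL' : (1 : ℝ) ≤ L := by exact_mod_cast hL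
  refine ⟨⟨min ⌊2 ^ j * y⌋₊ (2 ^ j - L), by omega⟩, ?_, ?_, ?_⟩
  · simp only; omega
  · exact le_trans (by exact_mod_cast min_le_left _ _) hfl
  · rcases min_choice ⌊2 ^ j * y⌋₊ (2 ^ j - L) with h | h
    · simp only [h]; linarith
    · simp only [h]
      rw [Nat.cast_sub hj]
      push_cast
      linarith

/-- Let `Z J` be the points never hit from scale J on. Around any x in it, each scale j ≥ J has a
ball of radius δ / 2^j, at distance comparable to its radius, that is hit entirely and so misses `Z
J`. Hence x is not a density point and `Z J` is null. -/
lemma ae_frequently_mem_dyadicHitSet {d' : ℕ} {ψ : ℝ → ℝ} (hψ : Continuous ψ) {c v : ℝ}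
    (hc : c < |ψ v|) :
    ∀ᵐ a ∂(volume.restrict (Set.Icc (0 : Fin d' → ℝ) 1)),
      ∃ᶠ j in atTop, a ∈ dyadicHitSet ψ c j := by
  obtain ⟨δ, hδ, hball⟩ : ∃ δ > 0, ∀ y, |y - v| ≤ δ → c ≤ |ψ y| := by
    have : ∀ᶠ y in 𝓝 v, c < |ψ y| := (hψ.abs.tendsto v).eventually_const_lt hc
    obtain ⟨δ, hδ, h⟩ := Metric.eventually_nhds_iff.1 this
    refine ⟨δ / 2, by positivity, fun y hy => (h ?_).le⟩
    rw [Real.dist_eq]; linarith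
  set Z : ℕ → Set (Fin d' → ℝ) := fun J =>
    Set.Icc 0 1 ∩ ⋂ j ≥ J, (dyadicHitSet ψ c j)ᶜ with hZ
  have hZm : ∀ J, MeasurableSet (Z J) := fun J =>
    measurableSet_Icc.inter (MeasurableSet.iInter fun j => MeasurableSet.iInter fun _ =>
      (measurableSet_dyadicHitSet hψ c j).compl)
  have hnull : ∀ J, volume (Z J) = 0 := by
    intro J
    rw [← Measure.restrict_eq_zero, ← ae_eq_bot, ← empty_mem_iff_bot]
    -- The balls are not centred at x. The factor (1 + |v|) / δ enlarges the ball around (k + v) /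
    -- 2^j enough to contain x, as 2^j x is within 1 of k.
    have hd := IsUnifLocDoublingMeasure.ae_tendsto_measure_inter_div
      (volume : Measure (Fin d' → ℝ)) (Z J) ((1 + |v|) / δ)
    filter_upwards [hd, ae_restrict_mem (hZm J)] with x hx hxZ
    have hk : ∀ j : ℕ, ∃ k : Fin d' → Fin (2 ^ j), ∀ i, |2 ^ j * x i - ((k i : ℕ) : ℝ)| ≤ 1 := by
      intro j
      have := fun i => exists_dyadic_block (j := j) le_rfl Nat.one_le_two_pow (hxZ.1.1 i)
        (hxZ.1.2 i)
      choose k _ hk1 hk2 using this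
      refine ⟨k, fun i => ?_⟩
      rw [abs_le]
      have h1 := hk1 i
      have h2 := hk2 i
      push_cast at h2
      constructor <;> linarith
    choose k hk using hk
    have hlim := hx (l := atTop) (fun j i => (((k j i : ℕ) : ℝ) + v) / 2 ^ j)
      (fun j : ℕ => δ / 2 ^ j) ?_ ?_
    · have hzero : ∀ᶠ j : ℕ in atTop,
          volume (Z J ∩ Metric.closedBall (fun i => (((k j i : ℕ) : ℝ) + v) / 2 ^ j) (δ / 2 ^ j)) /
            volume (Metric.closedBall (fun i : Fin d' => (((k j i : ℕ) : ℝ) + v) / 2 ^ j)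
              (δ / 2 ^ j)) = 0 := by
        filter_upwards [eventually_ge_atTop J] with j hj
        have : Z J ∩ Metric.closedBall (fun i => (((k j i : ℕ) : ℝ) + v) / 2 ^ j) (δ / 2 ^ j)
            = ∅ := by
          rw [Set.eq_empty_iff_forall_notMem]
          rintro a ⟨haZ, hab⟩
          refine Set.mem_iInter₂.1 haZ.2 j hj ⟨k j, fun i => hball _ ?_⟩
          have h2 : (0 : ℝ) < 2 ^ j := by positivity
          have := (dist_le_pi_dist _ _ i).trans (Metric.mem_closedBall.1 hab)
          rw [Real.dist_eq, le_div_iff₀ h2] at this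
          have e : 2 ^ j * a i - ((k j i : ℕ) : ℝ) - v =
              (a i - (((k j i : ℕ) : ℝ) + v) / 2 ^ j) * 2 ^ j := by
            field_simp
            ring
          rw [e, abs_mul, abs_of_pos h2]
          exact this
        rw [this, measure_empty, ENNReal.zero_div]
      have h0 := (tendsto_congr' hzero).1 hlim
      exact zero_ne_one (tendsto_nhds_unique tendsto_const_nhds h0)
    · refine tendsto_nhdsWithin_iff.2 ⟨?_, Eventually.of_forall fun j => ?_⟩
      · have := (tendsto_pow_atTop_atTop_of_one_lt (r := (2 : ℝ)) (by norm_num))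
        exact this.const_div_atTop δ
      · exact div_pos hδ (by positivity)
    · refine Eventually.of_forall fun j => ?_
      have h2 : (0 : ℝ) < 2 ^ j := by positivity
      rw [Metric.mem_closedBall, dist_pi_le_iff (by positivity)]
      intro i
      have e : x i - (((k j i : ℕ) : ℝ) + v) / 2 ^ j =
          (2 ^ j * x i - ((k j i : ℕ) : ℝ) - v) / 2 ^ j := by field_simp; ring
      have e' : (1 + |v|) / δ * (δ / 2 ^ j) = (1 + |v|) / 2 ^ j := by field_simp
      rw [Real.dist_eq, e, e', abs_div, abs_of_pos h2]
      gcongr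
      exact (abs_sub _ _).trans (add_le_add (hk j i) le_rfl)
  rw [ae_restrict_iff' measurableSet_Icc]
  have hall : ∀ᵐ a : Fin d' → ℝ, ∀ J, a ∉ Z J := ae_all_iff.2 fun J => measure_eq_zero_iff_ae_notMem.1 (hnull J)
  filter_upwards [hall] with a ha hI
  rw [frequently_atTop]
  intro J
  by_contra! hcon
  exact ha J ⟨hI, Set.mem_iInter₂.2 fun j hj => hcon j hj⟩

/-! ### Existence of traces -/

lemma besovBlock_le_besovNorm {D : ℕ} {s p : ℝ} {q : ℝ≥0∞} (hq : 0 < q) (c : WaveletCoeff D)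
    (n : ℕ) : besovBlock s p c n ≤ besovNorm s p q c := by
  unfold besovNorm
  split_ifs with h
  · exact le_iSup (fun n => besovBlock s p c n) n
  · have hr := ENNReal.toReal_pos hq.ne' h
    calc besovBlock s p c n = (besovBlock s p c n ^ q.toReal) ^ (1 / q.toReal) := by
          rw [← ENNReal.rpow_mul, mul_one_div_cancel hr.ne', ENNReal.rpow_one]
      _ ≤ _ := ENNReal.rpow_le_rpow (ENNReal.le_tsum n) (by positivity)

lemma sum_enorm_rpow_le_besovNorm {D : ℕ} {s p : ℝ} {q : ℝ≥0∞} (hp : 0 < p) (hq : 0 < q)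
    (c : WaveletCoeff D) (n : ℕ) :
    ∑ k, ∑ l, ‖c n k l‖ₑ ^ p ≤
      (2 : ℝ≥0∞) ^ ((D - s * p) * ((n : ℝ) + 1)) * besovNorm s p q c ^ p := by
  have h := ENNReal.rpow_le_rpow (besovBlock_le_besovNorm (s := s) (p := p) hq c n) hp.le
  rw [besovBlock, ENNReal.mul_rpow_of_nonneg _ _ hp.le, ← ENNReal.rpow_mul, ← ENNReal.rpow_mul,
    one_div_mul_cancel hp.ne', ENNReal.rpow_one] at h
  calc ∑ k, ∑ l, ‖c n k l‖ₑ ^ p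
      = (2 : ℝ≥0∞) ^ ((D - s * p) * ((n : ℝ) + 1)) *
        (2 ^ ((s - D / p) * ((n : ℝ) + 1) * p) * ∑ k, ∑ l, ‖c n k l‖ₑ ^ p) := by
        rw [← mul_assoc, ← ENNReal.rpow_add _ _ (by norm_num) (by norm_num)]
        have : ((D : ℝ) - s * p) * ((n : ℝ) + 1) + (s - D / p) * ((n : ℝ) + 1) * p = 0 := by
          field_simp
          ring
        rw [this, ENNReal.rpow_zero, one_mul]
    _ ≤ _ := by gcongr

lemma sum_abs_translate_le {ψ : ℝ → ℝ} {R : ℕ} {B : ℝ} (hB0 : 0 ≤ B)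
    (hR : ∀ y, (R : ℝ) ≤ |y| → ψ y = 0) (hB : ∀ y, |ψ y| ≤ B) (m : ℕ) (y : ℝ) :
    ∑ k : Fin m, |ψ (y - ((k : ℕ) : ℝ))| ≤ (2 * R + 1) * B := by
  classical
  set F : Finset (Fin m) := Finset.univ.filter (fun k => |y - ((k : ℕ) : ℝ)| < R) with hF
  have hcard : F.card ≤ 2 * R + 1 := by
    have h1 : F.card ≤ (Finset.Icc ⌈y - R⌉ ⌊y + R⌋).card := by
      refine Finset.card_le_card_of_injOn (fun k => ((k : ℕ) : ℤ)) ?_ ?_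
      · intro k hk
        have := abs_lt.1 (Finset.mem_filter.1 hk).2
        simp only [Finset.coe_Icc, Set.mem_Icc, Int.ceil_le, Int.le_floor, Int.cast_natCast]
        constructor <;> linarith
      · intro k _ k' _ h
        exact Fin.ext (Int.ofNat_inj.1 h)
    rw [Int.card_Icc] at h1
    have h2 : ⌊y + R⌋ + 1 - ⌈y - R⌉ ≤ ((2 * R + 1 : ℕ) : ℤ) := by
      have h3 := Int.floor_le (y + R)
      have h4 := Int.le_ceil (y - R)
      have h5 : ((⌊y + R⌋ + 1 - ⌈y - R⌉ : ℤ) : ℝ) ≤ (((2 * R + 1 : ℕ) : ℤ) : ℝ) := by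
        push_cast
        linarith
      exact_mod_cast h5
    omega
  calc ∑ k : Fin m, |ψ (y - ((k : ℕ) : ℝ))| = ∑ k ∈ F, |ψ (y - ((k : ℕ) : ℝ))| := by
        symm
        refine Finset.sum_subset (Finset.subset_univ _) fun k _ hk => ?_
        rw [hR, abs_zero]
        by_contra! hlt
        exact hk (by simp [hF, hlt])
    _ ≤ ∑ k ∈ F, B := Finset.sum_le_sum fun k _ => hB _
    _ ≤ (2 * R + 1) * B := by
        rw [Finset.sum_const, nsmul_eq_mul]
        gcongr
        exact_mod_cast hcard

/-- For a fixed type the sum over positions factors into one-dimensional sums, each with at most 2R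
+ 1 nonzero terms. Coefficients are bounded only where the wavelet is nonzero, since on a slice
nothing is known about the others. -/
lemma abs_sum_tensorWavelet_le {D : ℕ} {Ψ : Fin 2 → ℝ → ℝ} {R : ℕ} {B : ℝ} (hB0 : 0 ≤ B)
    (hR : ∀ l y, (R : ℝ) ≤ |y| → Ψ l y = 0) (hB : ∀ l y, |Ψ l y| ≤ B) (j : ℕ)
    (c : (Fin D → Fin (2 ^ j)) → {l : Fin D → Fin 2 // l ≠ 0} → ℝ) (y : Fin D → ℝ) {M : ℝ}
    (hM : 0 ≤ M) (hc : ∀ k l, tensorWavelet Ψ j k l.1 y ≠ 0 → |c k l| ≤ M) :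
    |∑ k, ∑ l, c k l * tensorWavelet Ψ j k l.1 y| ≤
      (Fintype.card {l : Fin D → Fin 2 // l ≠ 0} * ((2 * R + 1) * B) ^ D) * M := by
  have hterm : ∀ k l, |c k l * tensorWavelet Ψ j k l.1 y| ≤ M * |tensorWavelet Ψ j k l.1 y| := by
    intro k l
    rw [abs_mul]
    by_cases h : tensorWavelet Ψ j k l.1 y = 0
    · simp [h]
    · gcongr
      exact hc k l h
  have hsum : ∀ l : {l : Fin D → Fin 2 // l ≠ 0},
      ∑ k, |tensorWavelet Ψ j k l.1 y| ≤ ((2 * R + 1) * B) ^ D := by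
    intro l
    simp only [tensorWavelet, Finset.abs_prod]
    rw [← Fintype.piFinset_univ, Finset.sum_prod_piFinset Finset.univ
      (fun i (k : Fin (2 ^ j)) => |Ψ (l.1 i) (2 ^ j * y i - ((k : ℕ) : ℝ))|)]
    refine (Finset.prod_le_prod (fun i _ => Finset.sum_nonneg fun _ _ => abs_nonneg _)
      (fun i _ => sum_abs_translate_le hB0 (hR _) (hB _) _ _)).trans ?_
    simp
  calc |∑ k, ∑ l, c k l * tensorWavelet Ψ j k l.1 y|
      ≤ ∑ k, ∑ l : {l : Fin D → Fin 2 // l ≠ 0}, M * |tensorWavelet Ψ j k l.1 y| :=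
        (Finset.abs_sum_le_sum_abs _ _).trans (Finset.sum_le_sum fun k _ =>
          (Finset.abs_sum_le_sum_abs _ _).trans (Finset.sum_le_sum fun l _ => hterm k l))
    _ = ∑ l : {l : Fin D → Fin 2 // l ≠ 0}, M * ∑ k, |tensorWavelet Ψ j k l.1 y| := by
        rw [Finset.sum_comm]
        simp only [Finset.mul_sum]
    _ ≤ ∑ l : {l : Fin D → Fin 2 // l ≠ 0}, M * ((2 * R + 1) * B) ^ D :=
        Finset.sum_le_sum fun l _ => mul_le_mul_of_nonneg_left (hsum l) hM
    _ = _ := by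
        rw [Finset.sum_const, nsmul_eq_mul, Finset.card_univ]
        ring

/-- The part of the `p`-th power sum of the coefficients of scale `n + 1` that contributes to the
trace at `a`. -/
noncomputable def nearSum {d d' : ℕ} (p : ℝ) (R : ℕ) (c : WaveletCoeff (d + d')) (n : ℕ) (a : Fin d' → ℝ) :
    ℝ≥0∞ :=
  ∑ k, ∑ l, ‖c n k l‖ₑ ^ p * (Metric.closedBall
    (fun i => ((k (Fin.natAdd d i) : ℕ) : ℝ) / 2 ^ (n + 1)) (R / 2 ^ (n + 1))).indicator 1 a

lemma measurable_nearSum {d d' : ℕ} (p : ℝ) (R : ℕ) (c : WaveletCoeff (d + d')) (n : ℕ) :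
    Measurable (nearSum p R c n) := by
  unfold nearSum
  refine Finset.measurable_fun_sum _ fun k _ => Finset.measurable_fun_sum _ fun l _ => ?_
  exact (measurable_const.indicator measurableSet_closedBall).const_mul _

lemma lintegral_nearSum {d d' : ℕ} (p : ℝ) (R : ℕ) (c : WaveletCoeff (d + d')) (n : ℕ) :
    ∫⁻ a, nearSum p R c n a =
      ENNReal.ofReal ((2 * (R / 2 ^ (n + 1))) ^ d') * ∑ k, ∑ l, ‖c n k l‖ₑ ^ p := by
  have hm : ∀ k : Fin (d + d') → Fin (2 ^ (n + 1)), Measurable ((Metric.closedBall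
      (fun i : Fin d' => ((k (Fin.natAdd d i) : ℕ) : ℝ) / 2 ^ (n + 1))
        (R / 2 ^ (n + 1))).indicator (1 : (Fin d' → ℝ) → ℝ≥0∞)) :=
    fun k => measurable_const.indicator measurableSet_closedBall
  unfold nearSum
  rw [lintegral_finsetSum _ fun k _ => Finset.measurable_fun_sum _ fun l _ =>
    (hm k).const_mul _, Finset.mul_sum]
  refine Finset.sum_congr rfl fun k _ => ?_
  rw [lintegral_finsetSum _ fun l _ => (hm k).const_mul _, Finset.mul_sum]
  refine Finset.sum_congr rfl fun l _ => ?_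
  rw [lintegral_const_mul _ (hm k), lintegral_indicator_one measurableSet_closedBall,
    Real.volume_pi_closedBall _ (by positivity), mul_comm, Fintype.card_fin]

lemma enorm_coeff_rpow_le_nearSum {d d' : ℕ} {Ψ : Fin 2 → ℝ → ℝ} {p : ℝ} {R : ℕ}
    (hR : ∀ l y, (R : ℝ) ≤ |y| → Ψ l y = 0) (c : WaveletCoeff (d + d')) (n : ℕ)
    (x : Fin d → ℝ) (a : Fin d' → ℝ) (k : Fin (d + d') → Fin (2 ^ (n + 1)))
    (l : {l : Fin (d + d') → Fin 2 // l ≠ 0})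
    (h : tensorWavelet Ψ (n + 1) k l.1 (Fin.append x a) ≠ 0) :
    ‖c n k l‖ₑ ^ p ≤ nearSum p R c n a := by
  have hmem : a ∈ Metric.closedBall
      (fun i : Fin d' => ((k (Fin.natAdd d i) : ℕ) : ℝ) / 2 ^ (n + 1)) (R / 2 ^ (n + 1)) := by
    rw [Metric.mem_closedBall, dist_pi_le_iff (by positivity)]
    intro i
    have h1 : Ψ (l.1 (Fin.natAdd d i)) (2 ^ (n + 1) * a i - ((k (Fin.natAdd d i) : ℕ) : ℝ)) ≠ 0 := by
      have := Finset.prod_ne_zero_iff.1 h (Fin.natAdd d i) (Finset.mem_univ _)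
      rwa [Fin.append_right] at this
    have h2 : |2 ^ (n + 1) * a i - ((k (Fin.natAdd d i) : ℕ) : ℝ)| < R := by
      by_contra! hcon
      exact h1 (hR _ _ hcon)
    have h3 : (0 : ℝ) < 2 ^ (n + 1) := by positivity
    have e : a i - ((k (Fin.natAdd d i) : ℕ) : ℝ) / 2 ^ (n + 1) =
        (2 ^ (n + 1) * a i - ((k (Fin.natAdd d i) : ℕ) : ℝ)) / 2 ^ (n + 1) := by field_simp
    rw [Real.dist_eq, e, abs_div, abs_of_pos h3]
    gcongr
  unfold nearSum
  refine le_trans ?_ (Finset.single_le_sum (fun _ _ => zero_le) (Finset.mem_univ k))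
  refine le_trans ?_ (Finset.single_le_sum (fun _ _ => zero_le) (Finset.mem_univ l))
  rw [Set.indicator_of_mem hmem]
  simp

/-- Integration over a gains 2^(-d'j) on the Besov bound 2^((D - sp)j), leaving 2^(-(sp - d)j). -/
lemma ae_exists_nearSum_le {d d' : ℕ} {s p : ℝ} {q : ℝ≥0∞} (hp : 0 < p) (hq : 0 < q)
    (hs : d / p < s) (R : ℕ) (c : WaveletCoeff (d + d')) (hc : besovNorm s p q c < ∞) :
    ∃ ρ : ℝ, 0 < ρ ∧ ρ < 1 ∧ ∀ᵐ a, ∃ C : ℝ≥0,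
      ∀ n, nearSum p R c n a ≤ C * ENNReal.ofReal (ρ ^ (n + 1)) := by
  -- The integrals decay like ρ^(2j). One factor ρ^j is kept as the pointwise rate, the other makes
  -- the integrated series converge.
  set e : ℝ := (s * p - d) / 2 with he
  have he0 : 0 < e := by
    rw [div_lt_iff₀ hp] at hs
    rw [he]; linarith
  set ρ : ℝ := 2 ^ (-e) with hρ
  have hρ0 : 0 < ρ := by positivity
  have hρ1 : ρ < 1 := Real.rpow_lt_one_of_one_lt_of_neg (by norm_num) (by linarith)
  refine ⟨ρ, hρ0, hρ1, ?_⟩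
  set K : ℝ≥0∞ := ENNReal.ofReal ((2 * R) ^ d') * besovNorm s p q c ^ p with hK
  have hKtop : K < ∞ := ENNReal.mul_lt_top ENNReal.ofReal_lt_top
    (ENNReal.rpow_lt_top_of_nonneg hp.le hc.ne)
  have hint : ∀ n, ∫⁻ a, nearSum p R c n a ≤ K * ENNReal.ofReal (ρ ^ (n + 1) * ρ ^ (n + 1)) := by
    intro n
    rw [lintegral_nearSum]
    refine (mul_le_mul_right (sum_enorm_rpow_le_besovNorm (s := s) hp hq c n) _).trans (le_of_eq ?_)
    have e1 : (2 : ℝ≥0∞) ^ (((d + d' : ℕ) - s * p) * ((n : ℝ) + 1)) =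
        ENNReal.ofReal ((2 : ℝ) ^ (((d + d' : ℕ) - s * p) * ((n : ℝ) + 1))) := by
      rw [← ENNReal.ofReal_rpow_of_pos (by norm_num)]
      norm_num
    have e2 : (2 * (R / 2 ^ (n + 1)) : ℝ) ^ d' * (2 : ℝ) ^ (((d + d' : ℕ) - s * p) * ((n : ℝ) + 1)) =
        (2 * R) ^ d' * (ρ ^ (n + 1) * ρ ^ (n + 1)) := by
      have e3 : ρ ^ (n + 1) = (2 : ℝ) ^ (-e * ((n : ℝ) + 1)) := by
        rw [hρ, ← Real.rpow_natCast, ← Real.rpow_mul (by norm_num)]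
        push_cast; rfl
      have e4 : ((2 : ℝ) ^ (n + 1)) ^ d' = (2 : ℝ) ^ (((n : ℝ) + 1) * d') := by
        rw [← pow_mul, ← Real.rpow_natCast]
        push_cast; rfl
      rw [e3, ← mul_div_assoc, div_pow, e4, div_mul_eq_mul_div, mul_div_assoc,
        ← Real.rpow_sub (by norm_num), ← Real.rpow_add (by norm_num)]
      congr 2
      rw [he]
      push_cast
      ring
    rw [e1, hK, ← mul_assoc, ← ENNReal.ofReal_mul (by positivity), e2,
      ENNReal.ofReal_mul (by positivity)]
    ring
  have hpos : ∀ n : ℕ, ENNReal.ofReal (ρ ^ (n + 1)) ≠ 0 := fun n => by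
    rw [Ne, ENNReal.ofReal_eq_zero]; push Not; positivity
  have hsum : ∫⁻ a, ∑' n, nearSum p R c n a / ENNReal.ofReal (ρ ^ (n + 1)) ≠ ∞ := by
    rw [lintegral_tsum fun n => ((measurable_nearSum p R c n).div_const _).aemeasurable]
    have hle : ∀ n, ∫⁻ a, nearSum p R c n a / ENNReal.ofReal (ρ ^ (n + 1)) ≤
        K * ENNReal.ofReal (ρ ^ (n + 1)) := by
      intro n
      simp only [div_eq_mul_inv]
      rw [lintegral_mul_const _ (measurable_nearSum p R c n), ← div_eq_mul_inv]
      refine ENNReal.div_le_of_le_mul ((hint n).trans (le_of_eq ?_))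
      rw [ENNReal.ofReal_mul (by positivity), ← mul_assoc]
    refine ne_top_of_le_ne_top ?_ (ENNReal.tsum_le_tsum hle)
    rw [ENNReal.tsum_mul_left]
    refine ENNReal.mul_ne_top hKtop.ne ?_
    have hsm : Summable (fun n : ℕ => ρ ^ (n + 1)) :=
      (summable_nat_add_iff 1).2 (summable_geometric_of_lt_one hρ0.le hρ1)
    rw [← ENNReal.ofReal_tsum_of_nonneg (fun n => by positivity) hsm]
    exact ENNReal.ofReal_ne_top
  have hmeas : Measurable fun a => ∑' n, nearSum p R c n a / ENNReal.ofReal (ρ ^ (n + 1)) :=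
    Measurable.tsum fun n => (measurable_nearSum p R c n).div_const _
  filter_upwards [ae_lt_top hmeas hsum] with a ha
  refine ⟨(∑' n, nearSum p R c n a / ENNReal.ofReal (ρ ^ (n + 1))).toNNReal, fun n => ?_⟩
  rw [ENNReal.coe_toNNReal ha.ne]
  exact (ENNReal.div_le_iff (hpos n) ENNReal.ofReal_ne_top).1
    (ENNReal.le_tsum (f := fun n => nearSum p R c n a / ENNReal.ofReal (ρ ^ (n + 1))) n)

lemma ae_exists_isTrace {d d' : ℕ} {s p : ℝ} {q : ℝ≥0∞} (hp : 0 < p) (hq : 0 < q)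
    (hs : d / p < s) {Ψ : Fin 2 → ℝ → ℝ} {R : ℕ} {B : ℝ} (hB0 : 0 ≤ B)
    (hR : ∀ l y, (R : ℝ) ≤ |y| → Ψ l y = 0) (hB : ∀ l y, |Ψ l y| ≤ B)
    (c : WaveletCoeff (d + d')) (hc : besovNorm s p q c < ∞) :
    ∀ᵐ a : Fin d' → ℝ, ∃ g : (Fin d → ℝ) → ℝ, IsTrace Ψ c a g := by
  obtain ⟨ρ, hρ0, hρ1, hae⟩ := ae_exists_nearSum_le hp hq hs R c hc
  filter_upwards [hae] with a ⟨C, hC⟩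
  set K : ℝ := Fintype.card {l : Fin (d + d') → Fin 2 // l ≠ 0} * ((2 * R + 1) * B) ^ (d + d')
  have hbound : ∀ n k l x, tensorWavelet Ψ (n + 1) k l.1 (Fin.append x a) ≠ 0 →
      |c n k l| ≤ (C : ℝ) ^ (1 / p) * (ρ ^ (1 / p)) ^ (n + 1) := by
    intro n k l x h
    have h1 := (enorm_coeff_rpow_le_nearSum (p := p) hR c n x a k l h).trans (hC n)
    have h2 := ENNReal.rpow_le_rpow h1 (z := 1 / p) (by positivity)
    rw [← ENNReal.rpow_mul, mul_one_div_cancel hp.ne', ENNReal.rpow_one,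
      ENNReal.mul_rpow_of_nonneg _ _ (by positivity),
      ENNReal.ofReal_rpow_of_nonneg (by positivity) (by positivity),
      ← ENNReal.ofReal_coe_nnreal, ENNReal.ofReal_rpow_of_nonneg (by positivity) (by positivity),
      ← ENNReal.ofReal_mul (by positivity), Real.enorm_eq_ofReal_abs,
      ENNReal.ofReal_le_ofReal_iff (by positivity)] at h2
    rwa [Real.rpow_pow_comm hρ0.le]
  have hρp : ρ ^ (1 / p) < 1 := Real.rpow_lt_one hρ0.le hρ1 (by positivity)
  have hsm : Summable (fun n : ℕ => K * ((C : ℝ) ^ (1 / p) * (ρ ^ (1 / p)) ^ (n + 1))) :=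
    (((summable_nat_add_iff 1).2
      (summable_geometric_of_lt_one (by positivity) hρp)).mul_left _).mul_left _
  refine ⟨_, tendstoUniformly_tsum_nat (f := fun n (x : Fin d → ℝ) => ∑ k, ∑ l, c n k l *
    tensorWavelet Ψ (n + 1) k l.1 (Fin.append x a)) hsm fun n x => ?_⟩
  rw [Real.norm_eq_abs]
  exact abs_sum_tensorWavelet_le hB0 hR hB (n + 1) (c n) _ (by positivity) fun k l h => hbound n k l x h

/-! ### The topology of the Besov space -/

namespace BesovSpace

variable {D : ℕ} {s p : ℝ} {q : ℝ≥0∞} {hp : 0 < p} {hq : 0 < q}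

/-- The element of the Besov space with given wavelet coefficients. -/
def ofCoeff (c : WaveletCoeff D) (hc : besovNorm s p q c < ∞) : BesovSpace D s p q hp hq :=
  ⟨c, hc⟩

lemma isOpen_iff {U : Set (BesovSpace D s p q hp hq)} :
    IsOpen U ↔ ∀ f ∈ U, ∃ ε : ℝ, 0 < ε ∧
      ∀ g, besovNorm s p q (coeff (g - f)) < ENNReal.ofReal ε → g ∈ U := Iff.rfl

lemma enorm_coeff_le (c : WaveletCoeff D) (hp : 0 < p) (hq : 0 < q) (n : ℕ)
    (k : Fin D → Fin (2 ^ (n + 1))) (l : {l : Fin D → Fin 2 // l ≠ 0}) :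
    ‖c n k l‖ₑ ≤ ENNReal.ofReal (2 ^ ((D - s * p) * ((n : ℝ) + 1) * (1 / p))) *
      besovNorm s p q c := by
  have h1 : ‖c n k l‖ₑ ^ p ≤ ∑ k, ∑ l, ‖c n k l‖ₑ ^ p :=
    (Finset.single_le_sum (f := fun l => ‖c n k l‖ₑ ^ p) (fun _ _ => zero_le)
      (Finset.mem_univ l)).trans
      (Finset.single_le_sum (f := fun k => ∑ l, ‖c n k l‖ₑ ^ p) (fun _ _ => zero_le)
        (Finset.mem_univ k))
  have h2 := ENNReal.rpow_le_rpow (h1.trans (sum_enorm_rpow_le_besovNorm (s := s) hp hq c n))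
    (z := 1 / p) (by positivity)
  rw [← ENNReal.rpow_mul, mul_one_div_cancel hp.ne', ENNReal.rpow_one,
    ENNReal.mul_rpow_of_nonneg _ _ (by positivity), ← ENNReal.rpow_mul, ← ENNReal.rpow_mul,
    mul_one_div_cancel hp.ne', ENNReal.rpow_one] at h2
  refine h2.trans (le_of_eq ?_)
  rw [← ENNReal.ofReal_rpow_of_pos (by norm_num)]
  norm_num

lemma continuous_coeff (n : ℕ) (k : Fin D → Fin (2 ^ (n + 1)))
    (l : {l : Fin D → Fin 2 // l ≠ 0}) :
    Continuous (fun f : BesovSpace D s p q hp hq => f.coeff n k l) := by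
  rw [continuous_def]
  intro V hV
  rw [isOpen_iff]
  intro f hf
  obtain ⟨ε, hε, hball⟩ := Metric.isOpen_iff.1 hV _ hf
  set K : ℝ := 2 ^ ((D - s * p) * ((n : ℝ) + 1) * (1 / p)) with hK
  have hK0 : 0 < K := by positivity
  refine ⟨ε / K, by positivity, fun g hg => hball ?_⟩
  have h1 := enorm_coeff_le (s := s) (coeff (g - f)) hp hq n k l
  have h2 : ‖coeff (g - f) n k l‖ₑ < ENNReal.ofReal ε := by
    refine h1.trans_lt ?_
    have h3 := ENNReal.mul_lt_mul_right (a := ENNReal.ofReal K) (by simpa using hK0)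
      ENNReal.ofReal_ne_top hg
    rwa [← ENNReal.ofReal_mul hK0.le, mul_div_cancel₀ _ hK0.ne'] at h3
  rw [Real.enorm_eq_ofReal_abs, ENNReal.ofReal_lt_ofReal_iff hε] at h2
  exact h2

/-- The topology is defined through differences, hence is translation invariant. This is all the
vector-space continuity that the shyness argument uses. -/
lemma continuous_add_right (x : BesovSpace D s p q hp hq) : Continuous (fun f => f + x) := by
  rw [continuous_def]
  intro U hU
  rw [isOpen_iff] at hU ⊢
  intro f hf
  obtain ⟨ε, hε, h⟩ := hU _ hf
  exact ⟨ε, hε, fun g hg => h _ (by rwa [add_sub_add_right_eq_sub])⟩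

end BesovSpace

/-! ### The probe measure -/

/-- The indices of the wavelet coefficients. -/
abbrev WaveletIndex (D : ℕ) : Type :=
  Σ n : ℕ, (Fin D → Fin (2 ^ (n + 1))) × {l : Fin D → Fin 2 // l ≠ 0}

/-- The size `2 ^ (-s j) / j ^ γ`, `j = n + 1`, of the random coefficients of the probe. -/
noncomputable def probeWeight (s : ℝ) (γ n : ℕ) : ℝ :=
  2 ^ (-(s * ((n : ℝ) + 1))) * (1 / ((n : ℝ) + 1) ^ γ)

lemma probeWeight_pos (s : ℝ) (γ n : ℕ) : 0 < probeWeight s γ n := by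
  unfold probeWeight; positivity

/-- The random wavelet series whose coefficients of scale `n + 1` are independent and uniformly
distributed on `[0, probeWeight s γ n]`. -/
noncomputable def probeCoeff {D : ℕ} (s : ℝ) (γ : ℕ) (ω : WaveletIndex D → unitInterval) :
    WaveletCoeff D :=
  fun n k l => probeWeight s γ n * ω ⟨n, k, l⟩

/-- The 2^(jD) positions contribute 2^(jD/p), which together with 2^(-sj) cancels the Besov weight
exactly; only 1 / j^γ survives. -/
lemma besovBlock_le_of_abs_le {D : ℕ} {s p : ℝ} (hp : 0 < p) (γ : ℕ) (c : WaveletCoeff D) (n : ℕ)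
    (hc : ∀ k l, |c n k l| ≤ probeWeight s γ n) :
    besovBlock s p c n ≤ (Fintype.card {l : Fin D → Fin 2 // l ≠ 0} : ℝ≥0∞) ^ (1 / p) *
      ENNReal.ofReal (1 / ((n : ℝ) + 1) ^ γ) := by
  have h1 : ∑ k, ∑ l, ‖c n k l‖ₑ ^ p ≤ (2 : ℝ≥0∞) ^ (((n : ℝ) + 1) * D) *
      (Fintype.card {l : Fin D → Fin 2 // l ≠ 0} : ℝ≥0∞) *
        ENNReal.ofReal (probeWeight s γ n) ^ p := by
    have h2 : ∀ k l, ‖c n k l‖ₑ ^ p ≤ ENNReal.ofReal (probeWeight s γ n) ^ p := fun k l => by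
      rw [Real.enorm_eq_ofReal_abs]
      gcongr
      exact hc k l
    refine (Finset.sum_le_sum fun k _ => Finset.sum_le_sum fun l _ => h2 k l).trans (le_of_eq ?_)
    have h3 : (2 : ℝ≥0∞) ^ (((n : ℝ) + 1) * D) =
        (Fintype.card (Fin D → Fin (2 ^ (n + 1))) : ℝ≥0∞) := by
      rw [Fintype.card_fun, Fintype.card_fin, Fintype.card_fin, ← pow_mul]
      push_cast
      rw [← ENNReal.rpow_natCast]
      push_cast
      rfl
    rw [h3]
    simp only [Finset.sum_const, Finset.card_univ, nsmul_eq_mul]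
    ring
  have h4 := ENNReal.rpow_le_rpow h1 (z := 1 / p) (by positivity)
  rw [ENNReal.mul_rpow_of_nonneg _ _ (by positivity),
    ENNReal.mul_rpow_of_nonneg _ _ (by positivity), ← ENNReal.rpow_mul, ← ENNReal.rpow_mul,
    mul_one_div_cancel hp.ne', ENNReal.rpow_one] at h4
  unfold besovBlock
  refine (mul_le_mul_right h4 _).trans (le_of_eq ?_)
  have h5 : ENNReal.ofReal (probeWeight s γ n) =
      (2 : ℝ≥0∞) ^ (-(s * ((n : ℝ) + 1))) * ENNReal.ofReal (1 / ((n : ℝ) + 1) ^ γ) := by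
    rw [probeWeight, ENNReal.ofReal_mul (by positivity), ← ENNReal.ofReal_rpow_of_pos (by norm_num)]
    norm_num
  have h6 : (2 : ℝ≥0∞) ^ ((s - D / p) * ((n : ℝ) + 1)) * 2 ^ (((n : ℝ) + 1) * D * (1 / p)) *
      2 ^ (-(s * ((n : ℝ) + 1))) = 1 := by
    rw [← ENNReal.rpow_add _ _ (by norm_num) (by norm_num),
      ← ENNReal.rpow_add _ _ (by norm_num) (by norm_num)]
    convert ENNReal.rpow_zero
    field_simp
    ring
  rw [h5]
  calc _ = ((2 : ℝ≥0∞) ^ ((s - D / p) * ((n : ℝ) + 1)) * 2 ^ (((n : ℝ) + 1) * D * (1 / p)) *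
      2 ^ (-(s * ((n : ℝ) + 1)))) * ((Fintype.card {l : Fin D → Fin 2 // l ≠ 0} : ℝ≥0∞) ^ (1 / p) *
      ENNReal.ofReal (1 / ((n : ℝ) + 1) ^ γ)) := by ring
    _ = _ := by rw [h6, one_mul]

/-- Bounding the supremum by a sum lets q = ∞ be treated like finite q, with r = 1. -/
lemma exists_besovNorm_le_tsum (D : ℕ) (s p : ℝ) {q : ℝ≥0∞} (hq : 0 < q) :
    ∃ r : ℝ, 0 < r ∧ ∀ c : WaveletCoeff D,
      besovNorm s p q c ≤ (∑' n, besovBlock s p c n ^ r) ^ (1 / r) := by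
  by_cases h : q = ∞
  · refine ⟨1, one_pos, fun c => ?_⟩
    simp only [besovNorm, h, if_true, ENNReal.rpow_one, div_one]
    exact iSup_le fun n => ENNReal.le_tsum n
  · refine ⟨q.toReal, ENNReal.toReal_pos hq.ne' h, fun c => ?_⟩
    simp [besovNorm, h]

lemma tsum_probe_lt_top {K : ℝ≥0∞} (hK : K < ∞) {r : ℝ} (hr : 0 < r) {γ : ℕ}
    (hγ : 1 < γ * r) :
    ∑' n : ℕ, (K * ENNReal.ofReal (1 / ((n : ℝ) + 1) ^ γ)) ^ r < ∞ := by
  simp_rw [ENNReal.mul_rpow_of_nonneg _ _ hr.le]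
  rw [ENNReal.tsum_mul_left]
  refine ENNReal.mul_lt_top (ENNReal.rpow_lt_top_of_nonneg hr.le hK.ne) ?_
  have hs : Summable (fun n : ℕ => 1 / ((n : ℝ) + 1) ^ (γ * r)) := by
    have := (summable_nat_add_iff 1).2 (Real.summable_one_div_nat_rpow.2 hγ)
    simpa using this
  have he : ∀ n : ℕ, ENNReal.ofReal (1 / ((n : ℝ) + 1) ^ γ) ^ r =
      ENNReal.ofReal (1 / ((n : ℝ) + 1) ^ (γ * r)) := by
    intro n
    rw [ENNReal.ofReal_rpow_of_nonneg (by positivity) hr.le, Real.div_rpow (by positivity)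
      (by positivity), Real.one_rpow, ← Real.rpow_natCast, ← Real.rpow_mul (by positivity)]
  simp_rw [he]
  rw [← ENNReal.ofReal_tsum_of_nonneg (fun n => by positivity) hs]
  exact ENNReal.ofReal_lt_top

lemma abs_probeCoeff_le {D : ℕ} (s : ℝ) (γ : ℕ) (ω : WaveletIndex D → unitInterval) (n : ℕ)
    (k : Fin D → Fin (2 ^ (n + 1))) (l : {l : Fin D → Fin 2 // l ≠ 0}) :
    |probeCoeff s γ ω n k l| ≤ probeWeight s γ n := by
  rw [probeCoeff, abs_mul, abs_of_pos (probeWeight_pos s γ n), abs_of_nonneg (ω _).2.1]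
  exact mul_le_of_le_one_right (probeWeight_pos s γ n).le (ω _).2.2

lemma abs_probeCoeff_sub_le {D : ℕ} (s : ℝ) (γ : ℕ) (ω ω' : WaveletIndex D → unitInterval) (n : ℕ)
    (k : Fin D → Fin (2 ^ (n + 1))) (l : {l : Fin D → Fin 2 // l ≠ 0}) :
    |(probeCoeff s γ ω - probeCoeff s γ ω') n k l| ≤ probeWeight s γ n := by
  have h : (probeCoeff s γ ω - probeCoeff s γ ω') n k l =
      probeWeight s γ n * (ω ⟨n, k, l⟩ - ω' ⟨n, k, l⟩) := by
    simp only [Pi.sub_apply, probeCoeff]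
    ring
  rw [h, abs_mul, abs_of_pos (probeWeight_pos s γ n)]
  refine mul_le_of_le_one_right (probeWeight_pos s γ n).le (abs_le.2 ?_)
  have h1 := (ω ⟨n, k, l⟩).2
  have h2 := (ω' ⟨n, k, l⟩).2
  constructor <;> linarith [h1.1, h1.2, h2.1, h2.2]

lemma tendsto_besovBlock_probeCoeff_sub {D : ℕ} {s p : ℝ} (hp : 0 < p) (γ : ℕ)
    (ω₀ : WaveletIndex D → unitInterval) (n : ℕ) :
    Tendsto (fun ω => besovBlock s p (probeCoeff s γ ω - probeCoeff s γ ω₀) n) (𝓝 ω₀) (𝓝 0) := by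
  have hc : Continuous (fun ω : WaveletIndex D → unitInterval =>
      ∑ k, ∑ l, ‖(probeCoeff s γ ω - probeCoeff s γ ω₀) n k l‖ₑ ^ p) := by
    refine continuous_finsetSum _ fun k _ => continuous_finsetSum _ fun l _ => ?_
    refine ENNReal.continuous_rpow_const.comp (continuous_enorm.comp ?_)
    simp only [Pi.sub_apply, probeCoeff]
    fun_prop
  have h1 := (ENNReal.continuous_rpow_const (y := 1 / p)).comp hc
  have h2 := ENNReal.Tendsto.const_mul (a := (2 : ℝ≥0∞) ^ ((s - D / p) * ((n : ℝ) + 1)))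
    (h1.tendsto ω₀) (Or.inr (ENNReal.rpow_ne_top_of_ne_zero (by norm_num) (by norm_num)))
  have hz : besovBlock s p (probeCoeff s γ ω₀ - probeCoeff s γ ω₀) n = 0 := by
    rw [sub_self]
    simpa using besovBlock_smul (s := s) hp 0 (0 : WaveletCoeff D) n
  rw [← hz]
  exact h2

/-- Random wavelet series with almost saturating independent coefficients depend continuously on
their coefficients, in the Besov topology. -/
lemma exists_probe_continuous (D : ℕ) (s p : ℝ) (q : ℝ≥0∞) (hp : 0 < p) (hq : 0 < q) :
    ∃ (γ : ℕ) (X : (WaveletIndex D → unitInterval) → BesovSpace D s p q hp hq),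
      Continuous X ∧ ∀ ω, (X ω).coeff = probeCoeff s γ ω := by
  obtain ⟨r, hr, hnorm⟩ := exists_besovNorm_le_tsum D s p hq
  obtain ⟨γ, hγ⟩ := exists_nat_gt (1 / r)
  rw [div_lt_iff₀ hr] at hγ
  set K : ℝ≥0∞ := (Fintype.card {l : Fin D → Fin 2 // l ≠ 0} : ℝ≥0∞) ^ (1 / p) with hK
  have hKtop : K < ∞ := ENNReal.rpow_lt_top_of_nonneg (by positivity) (by simp)
  have hfin := tsum_probe_lt_top hKtop hr hγ
  have hmem : ∀ ω : WaveletIndex D → unitInterval,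
      besovNorm s p q (probeCoeff s γ ω) < ∞ := by
    intro ω
    refine (hnorm _).trans_lt (ENNReal.rpow_lt_top_of_nonneg (by positivity) ?_)
    refine ne_top_of_le_ne_top hfin.ne (ENNReal.tsum_le_tsum fun n => ?_)
    gcongr
    exact besovBlock_le_of_abs_le hp γ _ n (abs_probeCoeff_le s γ ω n)
  refine ⟨γ, fun ω => BesovSpace.ofCoeff (probeCoeff s γ ω) (hmem ω), ?_, fun ω => rfl⟩
  rw [continuous_def]
  intro U hU
  rw [isOpen_iff_mem_nhds]
  intro ω₀ hω₀
  obtain ⟨ε, hε, h⟩ := BesovSpace.isOpen_iff.1 hU _ hω₀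
  have hlim : Tendsto (fun ω => ∑' n, besovBlock s p (probeCoeff s γ ω - probeCoeff s γ ω₀) n ^ r)
      (𝓝 ω₀) (𝓝 0) := by
    -- Dominated convergence for series: each block involves finitely many coordinates, and the
    -- summable bound does not depend on ω.
    have := tendsto_lintegral_filter_of_dominated_convergence (μ := Measure.count) (l := 𝓝 ω₀)
      (F := fun ω n => besovBlock s p (probeCoeff s γ ω - probeCoeff s γ ω₀) n ^ r)
      (f := fun _ => 0)
      (fun n : ℕ => (K * ENNReal.ofReal (1 / ((n : ℝ) + 1) ^ γ)) ^ r)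
      (Eventually.of_forall fun ω => measurable_of_countable _)
      (Eventually.of_forall fun ω => ae_of_all _ fun n => by
        gcongr
        exact besovBlock_le_of_abs_le hp γ _ n (abs_probeCoeff_sub_le s γ ω ω₀ n))
      (by rw [lintegral_count]; exact hfin.ne)
      (ae_of_all _ fun n => by
        have := (ENNReal.continuous_rpow_const (y := r)).tendsto 0 |>.comp
          (tendsto_besovBlock_probeCoeff_sub (s := s) hp γ ω₀ n)
        simpa [hr, Function.comp_def] using this)
    simpa [lintegral_count] using this
  have hlim' := ((ENNReal.continuous_rpow_const (y := 1 / r)).tendsto 0).comp hlim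
  rw [ENNReal.zero_rpow_of_pos (by positivity)] at hlim'
  have hev := hlim'.eventually_lt_const (ENNReal.ofReal_pos.2 hε)
  filter_upwards [hev] with ω hω
  exact h _ ((hnorm _).trans_lt hω)

/-! ### Locally flat traces -/

/-- The number of independent finite differences tested in each block. -/
def testCount (d m : ℕ) : ℕ := (m + 1) * (d + 1)

/-- The length of a block, in units of the dyadic scale. -/
def blockLength (d R m : ℕ) : ℕ := 2 * R * (testCount d m * (m + 2)) + 2 * R

/-- The offset of the `i`-th node of the `t`-th finite difference in a block. -/
def nodeOffset (R m t i : ℕ) : ℕ := 2 * R * (t * (m + 2) + i)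

section FlatTrace

variable {d d' : ℕ}

/-- The spare 2R absorbs the shift R + v of the nodes, which lies between 0 and 2R when |v| < R. -/
lemma nodeOffset_add_le {R m t i : ℕ} (ht : t < testCount d m) (hi : i ≤ m + 1) :
    nodeOffset R m t i + 2 * R ≤ blockLength d R m := by
  unfold nodeOffset blockLength
  have : t * (m + 2) + i ≤ testCount d m * (m + 2) := by
    have : (t + 1) * (m + 2) ≤ testCount d m * (m + 2) := Nat.mul_le_mul_right _ ht
    nlinarith
  gcongr

/-- The base point of the `t`-th finite difference in the block at `κ`. -/
noncomputable def testPoint (R m : ℕ) (v : ℝ) (e : Fin d) (j : ℕ) (κ : Fin d → Fin (2 ^ j))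
    (t : ℕ) : Fin d → ℝ :=
  fun i => (((κ i : ℕ) : ℝ) + R + v + if i = e then (nodeOffset R m t 0 : ℝ) else 0) / 2 ^ j

/-- The step of the finite differences of scale `j`. -/
noncomputable def testStep (R : ℕ) (e : Fin d) (j : ℕ) : Fin d → ℝ :=
  fun i => if i = e then 2 * R / 2 ^ j else 0

lemma two_pow_mul_testNode (R m : ℕ) (v : ℝ) (e : Fin d) (j : ℕ) (κ : Fin d → Fin (2 ^ j))
    (t i : ℕ) (b : Fin d) :
    2 ^ j * (testPoint R m v e j κ t + (i : ℝ) • testStep R e j) b =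
      ((κ b : ℕ) : ℝ) + R + v + if b = e then (nodeOffset R m t i : ℝ) else 0 := by
  simp only [testPoint, testStep, Pi.add_apply, Pi.smul_apply, smul_eq_mul, nodeOffset]
  split_ifs
  · push_cast
    field_simp
    ring
  · field_simp
    ring

/-- The finite difference of the partial sum of order `J`, restricted to the trace at `a`. -/
noncomputable def testDiff (Ψ : Fin 2 → ℝ → ℝ) (R m : ℕ) (v : ℝ) (e : Fin d) (j : ℕ)
    (κ : Fin d → Fin (2 ^ j)) (t : ℕ) (c : WaveletCoeff (d + d')) (J : ℕ) (a : Fin d' → ℝ) : ℝ :=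
  finiteDiff (m + 1) (testStep R e j) (testPoint R m v e j κ t)
    (fun x => waveletPartialSum Ψ c J (Fin.append x a))

/-- The size of the finite differences of scale `n + 1` that a Hölder exponent larger than
`s + 1 / (m + 1)` allows. -/
noncomputable def flatBound (s : ℝ) (m n : ℕ) : ℝ := 2 ^ (-(s + 1 / ((m : ℝ) + 1)) * ((n : ℝ) + 1))

lemma flatBound_pos (s : ℝ) (m n : ℕ) : 0 < flatBound s m n := by
  unfold flatBound; positivity

/-- At every large scale at which `a` is hit, the trace at `a` has small finite differences in some
block. -/
def IsFlatTrace (Ψ : Fin 2 → ℝ → ℝ) (s : ℝ) (R : ℕ) (v τ : ℝ) (e : Fin d) (m : ℕ)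
    (c : WaveletCoeff (d + d')) (a : Fin d' → ℝ) : Prop :=
  ∃ n₀ : ℕ, ∀ n ≥ n₀, a ∈ dyadicHitSet (Ψ 1) τ (n + 1) →
    ∃ κ : Fin d → Fin (2 ^ (n + 1)), (∀ i, (κ i : ℕ) + blockLength d R m ≤ 2 ^ (n + 1)) ∧
      ∃ J₀ : ℕ, ∀ J ≥ J₀, ∀ t : Fin (testCount d m),
        |testDiff Ψ R m v e (n + 1) κ t c J a| ≤ flatBound s m n

lemma eventually_holder_bound_lt {s α : ℝ} {m : ℕ} (hm : 1 / ((m : ℝ) + 1) < α - s) (C : ℝ)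
    {L : ℝ} (hL : 0 ≤ L) :
    ∀ᶠ n : ℕ in atTop, 2 ^ (m + 1) * (C * (L / 2 ^ (n + 1)) ^ α) < flatBound s m n := by
  set β : ℝ := α - s - 1 / ((m : ℝ) + 1) with hβ
  have hβ0 : 0 < β := by linarith
  have h1 : Tendsto (fun n : ℕ => ((2 : ℝ) ^ β) ^ (n + 1)) atTop atTop :=
    (tendsto_pow_atTop_atTop_of_one_lt (Real.one_lt_rpow (by norm_num) hβ0)).comp
      (tendsto_add_atTop_nat 1)
  filter_upwards [h1.eventually_gt_atTop (2 ^ (m + 1) * C * L ^ α)] with n hn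
  have h2 : (0 : ℝ) < 2 ^ (-α * ((n : ℝ) + 1)) := by positivity
  have h3 : (L / 2 ^ (n + 1)) ^ α = L ^ α * 2 ^ (-α * ((n : ℝ) + 1)) := by
    rw [Real.div_rpow hL (by positivity), div_eq_mul_inv, ← Real.rpow_natCast,
      ← Real.rpow_mul (by norm_num), ← Real.rpow_neg (by norm_num)]
    push_cast
    ring_nf
  have h4 : flatBound s m n = ((2 : ℝ) ^ β) ^ (n + 1) * 2 ^ (-α * ((n : ℝ) + 1)) := by
    rw [flatBound, ← Real.rpow_natCast, ← Real.rpow_mul (by norm_num),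
      ← Real.rpow_add (by norm_num)]
    push_cast
    rw [hβ]
    ring_nf
  rw [h3, h4]
  nlinarith

lemma isFlatTrace_of_pointwiseHolderWithin {Ψ : Fin 2 → ℝ → ℝ} {s : ℝ} {R : ℕ} (hR : 1 ≤ R)
    {v : ℝ} (hv : |v| < R) (τ : ℝ) (e : Fin d) {c : WaveletCoeff (d + d')} {a : Fin d' → ℝ}
    {g : (Fin d → ℝ) → ℝ} (hg : IsTrace Ψ c a g) {x₀ : Fin d → ℝ}
    (hx₀ : x₀ ∈ Set.Icc (0 : Fin d → ℝ) 1) {α : ℝ≥0}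
    (hα : PointwiseHolderWithin α g (Set.Icc 0 1) x₀) (hs : s < α) :
    ∃ m, IsFlatTrace Ψ s R v τ e m c a := by
  obtain ⟨P, hP, C, hC, hev⟩ := hα
  obtain ⟨m₁, hm₁⟩ := exists_nat_one_div_lt (sub_pos.2 hs)
  -- The first entry gives 1/(m+1) < α - s; the second makes the order m + 1 exceed the degree of P.
  set m := max m₁ ⌊α⌋₊ with hm
  have hm_lt : 1 / ((m : ℝ) + 1) < α - s := by
    refine lt_of_le_of_lt (one_div_le_one_div_of_le (by positivity) ?_) hm₁
    have : (m₁ : ℝ) ≤ m := by exact_mod_cast le_max_left _ _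
    linarith
  have hPm : P.totalDegree < m + 1 := Nat.lt_succ_of_le (hP.trans (le_max_right _ _))
  refine ⟨m, ?_⟩
  obtain ⟨η, hη, hloc⟩ := Metric.eventually_nhds_iff.1 (eventually_nhdsWithin_iff.1 hev)
  set L := blockLength d R m with hL
  have hL1 : 1 ≤ L := by rw [hL, blockLength]; omega
  have hpow : Tendsto (fun n : ℕ => (2 : ℝ) ^ (n + 1)) atTop atTop :=
    (tendsto_pow_atTop_atTop_of_one_lt (by norm_num)).comp (tendsto_add_atTop_nat 1)
  have hsmall := (hpow.const_div_atTop (L : ℝ)).eventually_lt_const hη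
  have hlarge := hpow.eventually_ge_atTop (L : ℝ)
  obtain ⟨n₀, hn₀⟩ := eventually_atTop.1
    (hsmall.and (hlarge.and (eventually_holder_bound_lt hm_lt C (Nat.cast_nonneg L))))
  refine ⟨n₀, fun n hn _ => ?_⟩
  obtain ⟨h1, h2, h3⟩ := hn₀ n hn
  have h2' : L ≤ 2 ^ (n + 1) := by exact_mod_cast h2
  -- The block contains x₀ and stays inside the cube even when x₀ is on the boundary, so every node
  -- lies where the Hölder estimate is available.
  have := fun i => exists_dyadic_block hL1 h2' (hx₀.1 i) (hx₀.2 i)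
  choose κ hκ1 hκ2 hκ3 using this
  refine ⟨κ, hκ1, ?_⟩
  have hpos : (0 : ℝ) < 2 ^ (n + 1) := by positivity
  have hnode : ∀ t < testCount d m, ∀ i ≤ m + 1,
      |g (testPoint R m v e (n + 1) κ t + (i : ℝ) • testStep R e (n + 1)) -
        MvPolynomial.eval (testPoint R m v e (n + 1) κ t + (i : ℝ) • testStep R e (n + 1) - x₀) P| ≤
      C * (L / 2 ^ (n + 1)) ^ (α : ℝ) := by
    intro t ht i hi
    set y := testPoint R m v e (n + 1) κ t + (i : ℝ) • testStep R e (n + 1) with hy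
    have hb : ∀ b, ((κ b : ℕ) : ℝ) ≤ 2 ^ (n + 1) * y b ∧
        2 ^ (n + 1) * y b ≤ ((κ b : ℕ) : ℝ) + L := by
      intro b
      rw [hy, two_pow_mul_testNode]
      have ho : ((nodeOffset R m t i : ℕ) : ℝ) + 2 * R ≤ L := by
        exact_mod_cast nodeOffset_add_le ht hi
      have ho' : (0 : ℝ) ≤ (nodeOffset R m t i : ℝ) := Nat.cast_nonneg _
      have hv' := abs_lt.1 hv
      split_ifs <;> constructor <;> linarith [hv'.1, hv'.2]
    have hyI : y ∈ Set.Icc (0 : Fin d → ℝ) 1 := by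
      constructor
      · intro b
        have h0 : (0 : ℝ) ≤ ((κ b : ℕ) : ℝ) := Nat.cast_nonneg _
        exact nonneg_of_mul_nonneg_right (h0.trans (hb b).1) hpos
      · intro b
        have h5 : ((κ b : ℕ) : ℝ) + L ≤ 2 ^ (n + 1) := by exact_mod_cast hκ1 b
        have h6 := (hb b).2.trans h5
        exact le_of_mul_le_mul_left (by simpa using h6) hpos
    have hdist : ‖y - x₀‖ ≤ L / 2 ^ (n + 1) := by
      rw [pi_norm_le_iff_of_nonneg (by positivity)]
      intro b
      rw [Pi.sub_apply, Real.norm_eq_abs, le_div_iff₀ hpos, ← abs_of_pos hpos, ← abs_mul, abs_le]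
      constructor <;> nlinarith [hb b, hκ2 b, hκ3 b]
    have h7 := hloc (by rw [dist_eq_norm]; exact hdist.trans_lt h1) hyI
    refine h7.trans ?_
    gcongr
  have hT : ∀ t < testCount d m, |finiteDiff (m + 1) (testStep R e (n + 1))
      (testPoint R m v e (n + 1) κ t) g| < flatBound s m n := by
    intro t ht
    have h8 : finiteDiff (m + 1) (testStep R e (n + 1)) (testPoint R m v e (n + 1) κ t) g =
        finiteDiff (m + 1) (testStep R e (n + 1)) (testPoint R m v e (n + 1) κ t)
          (fun x => g x - MvPolynomial.eval (x - x₀) P) := by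
      have := finiteDiff_add (m + 1) (testStep R e (n + 1)) (testPoint R m v e (n + 1) κ t)
        (fun x => g x - MvPolynomial.eval (x - x₀) P) (fun x => MvPolynomial.eval (x - x₀) P)
      simp only [sub_add_cancel] at this
      rw [this, finiteDiff_polynomial _ _ _ _ hPm, add_zero]
    rw [h8]
    exact (abs_finiteDiff_le _ _ _ _ (hnode t ht)).trans_lt h3
  -- The inequality for the trace is strict, so it passes to all late partial sums.
  have hall : ∀ᶠ J in atTop, ∀ t : Fin (testCount d m),
      |testDiff Ψ R m v e (n + 1) κ t c J a| ≤ flatBound s m n := by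
    rw [eventually_all]
    intro t
    exact ((tendsto_finiteDiff (m + 1) (testStep R e (n + 1)) (testPoint R m v e (n + 1) κ t)
      hg).abs.eventually_lt_const (hT t t.2)).mono fun _ h => h.le
  exact eventually_atTop.1 hall

lemma measurable_waveletPartialSum {s p : ℝ} {q : ℝ≥0∞} {hp : 0 < p} {hq : 0 < q}
    {Ψ : Fin 2 → ℝ → ℝ} (hΨ : ∀ l, Continuous (Ψ l)) (J : ℕ) (x : Fin d → ℝ) :
    Measurable (fun z : BesovSpace (d + d') s p q hp hq × (Fin d' → ℝ) =>
      waveletPartialSum Ψ z.1.coeff J (Fin.append x z.2)) := by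
  unfold waveletPartialSum
  refine Finset.measurable_fun_sum _ fun n _ => Finset.measurable_fun_sum _ fun k _ =>
    Finset.measurable_fun_sum _ fun l _ => Measurable.mul ?_ ?_
  · exact (BesovSpace.continuous_coeff n k l).measurable.comp measurable_fst
  · refine Measurable.comp (g := fun a => tensorWavelet Ψ (n + 1) k l.1 (Fin.append x a)) ?_
      measurable_snd
    simp only [tensorWavelet, Fin.prod_univ_add, Fin.append_left, Fin.append_right]
    refine Continuous.measurable ?_
    have := hΨ
    fun_prop

/-- Flatness speaks of partial sums instead of their limit, so it makes sense without a trace and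
uses only countable quantifiers over functions measurable in f and a jointly, as Fubini requires. -/
lemma measurableSet_isFlatTrace {s p : ℝ} {q : ℝ≥0∞} {hp : 0 < p} {hq : 0 < q}
    {Ψ : Fin 2 → ℝ → ℝ} (hΨ : ∀ l, Continuous (Ψ l)) (R : ℕ) (v τ : ℝ) (e : Fin d) (m : ℕ) :
    MeasurableSet {z : BesovSpace (d + d') s p q hp hq × (Fin d' → ℝ) |
      IsFlatTrace Ψ s R v τ e m z.1.coeff z.2} := by
  have hT : ∀ (n : ℕ) (κ : Fin d → Fin (2 ^ (n + 1))) (t J : ℕ),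
      Measurable (fun z : BesovSpace (d + d') s p q hp hq × (Fin d' → ℝ) =>
        testDiff Ψ R m v e (n + 1) κ t z.1.coeff J z.2) := by
    intro n κ t J
    unfold testDiff finiteDiff
    exact Finset.measurable_fun_sum _ fun i _ =>
      (measurable_waveletPartialSum hΨ J _).const_mul _
  unfold IsFlatTrace
  rw [measurableSet_setOfPred]
  refine Measurable.exists fun n₀ => Measurable.forall fun n => Measurable.imp measurable_const
    (Measurable.imp ?_ (Measurable.exists fun κ => Measurable.and measurable_const
      (Measurable.exists fun J₀ => Measurable.forall fun J => Measurable.imp measurable_const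
        (Measurable.forall fun t => ?_))))
  · exact measurableSet_setOfPred.1 (measurable_snd (measurableSet_dyadicHitSet (hΨ 1) τ (n + 1)))
  · exact measurableSet_setOfPred.1 (measurableSet_le (hT n κ t J).abs measurable_const)

end FlatTrace

/-! ### The probe has no flat traces -/

section Probe

variable {d d' : ℕ}

lemma tensorWavelet_append (Ψ : Fin 2 → ℝ → ℝ) (j : ℕ) (k : Fin d → Fin (2 ^ j))
    (k' : Fin d' → Fin (2 ^ j)) (l₀ : Fin 2) (x : Fin d → ℝ) (a : Fin d' → ℝ) :
    tensorWavelet Ψ j (Fin.append k k') (fun _ => l₀) (Fin.append x a) =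
      (∏ i, Ψ l₀ (2 ^ j * x i - ((k i : ℕ) : ℝ))) *
        ∏ i, Ψ l₀ (2 ^ j * a i - ((k' i : ℕ) : ℝ)) := by
  simp only [tensorWavelet, Fin.prod_univ_add, Fin.append_left, Fin.append_right]

/-- The position of the wavelet seen by the `t`-th finite difference in the block at `κ`. -/
def testPosition (R m : ℕ) (e : Fin d) (j : ℕ) (κ : Fin d → Fin (2 ^ j)) (hR : 1 ≤ R)
    (hκ : ∀ i, (κ i : ℕ) + blockLength d R m ≤ 2 ^ j) (t : Fin (testCount d m)) :
    Fin d → Fin (2 ^ j) :=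
  fun i => ⟨κ i + R + if i = e then nodeOffset R m t 0 else 0, by
    have h1 := hκ i
    have h2 : nodeOffset R m t 0 + 2 * R ≤ blockLength d R m :=
      nodeOffset_add_le t.2 (Nat.zero_le _)
    split_ifs <;> omega⟩

lemma testPosition_injective {R m : ℕ} (e : Fin d) (j : ℕ) (κ : Fin d → Fin (2 ^ j)) (hR : 1 ≤ R)
    (hκ : ∀ i, (κ i : ℕ) + blockLength d R m ≤ 2 ^ j) :
    Function.Injective (testPosition R m e j κ hR hκ) := by
  intro t t' h
  have h1 := congrArg Fin.val (congrFun h e)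
  simp only [testPosition, if_true, nodeOffset, add_zero, add_right_inj] at h1
  have h2 := Nat.eq_of_mul_eq_mul_left (by omega) h1
  exact Fin.ext (Nat.eq_of_mul_eq_mul_right (by omega) h2)

/-- In units of 2R the offset is t (m + 2) + i, and i is a digit in base m + 2; distinct pairs give
distinct integers. -/
lemma nodeOffset_sub_eq_zero_or {R m t t' i : ℕ} (hi : i ≤ m + 1) :
    (t = t' ∧ i = 0) ∨
      (2 * R : ℝ) ≤ |(nodeOffset R m t i : ℝ) - (nodeOffset R m t' 0 : ℝ)| := by
  by_cases h : t = t' ∧ i = 0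
  · exact Or.inl h
  · right
    set z : ℤ := ((t : ℤ) - t') * (m + 2) + i with hz
    have hz0 : z ≠ 0 := by
      intro h0
      apply h
      have hi' : (i : ℤ) ≤ m + 1 := by exact_mod_cast hi
      have hi0 : (0 : ℤ) ≤ i := Int.natCast_nonneg i
      have hm0 : (0 : ℤ) ≤ m := Int.natCast_nonneg m
      rcases lt_trichotomy (t : ℤ) t' with hlt | heq | hgt
      · have : ((t : ℤ) - t') * (m + 2) ≤ (-1) * (m + 2) :=
          mul_le_mul_of_nonneg_right (by omega) (by omega)
        omega
      · rw [hz, heq, sub_self, zero_mul, zero_add] at h0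
        exact ⟨by exact_mod_cast heq, by exact_mod_cast h0⟩
      · have : 1 * ((m : ℤ) + 2) ≤ ((t : ℤ) - t') * (m + 2) :=
          mul_le_mul_of_nonneg_right (by omega) (by omega)
        omega
    have h1 : (nodeOffset R m t i : ℝ) - (nodeOffset R m t' 0 : ℝ) = 2 * R * (z : ℝ) := by
      rw [hz]
      simp only [nodeOffset]
      push_cast
      ring
    have h2 : (1 : ℝ) ≤ |(z : ℝ)| := by exact_mod_cast Int.one_le_abs hz0
    rw [h1, abs_mul, abs_of_nonneg (by positivity : (0 : ℝ) ≤ 2 * R)]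
    exact le_mul_of_one_le_right (by positivity) h2

lemma tensorWavelet_testNode_eq_zero {Ψ : Fin 2 → ℝ → ℝ} {R : ℕ} (hR : 1 ≤ R)
    (hsupp : ∀ l y, (R : ℝ) ≤ |y| → Ψ l y = 0) {v : ℝ} (hv : |v| < R) {m : ℕ} (e : Fin d) (j : ℕ)
    (κ : Fin d → Fin (2 ^ j)) (hκ : ∀ i, (κ i : ℕ) + blockLength d R m ≤ 2 ^ j)
    (k' : Fin d' → Fin (2 ^ j)) (a : Fin d' → ℝ) (t t' : Fin (testCount d m)) {i : ℕ}
    (hi : i ≤ m + 1) (hne : ¬ (t = t' ∧ i = 0)) :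
    tensorWavelet Ψ j (Fin.append (testPosition R m e j κ hR hκ t') k') (fun _ => 1)
      (Fin.append (testPoint R m v e j κ t + (i : ℝ) • testStep R e j) a) = 0 := by
  rw [tensorWavelet_append, Finset.prod_eq_zero (Finset.mem_univ e), zero_mul]
  apply hsupp
  rw [two_pow_mul_testNode]
  simp only [testPosition, if_true]
  push_cast
  have h1 := (nodeOffset_sub_eq_zero_or (R := R) (t := t) (t' := t') hi).resolve_left
    (fun h => hne ⟨Fin.ext h.1, h.2⟩)
  have h2 : ((κ e : ℕ) : ℝ) + R + v + (nodeOffset R m t i : ℝ) -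
      (((κ e : ℕ) : ℝ) + R + (nodeOffset R m t' 0 : ℝ)) =
      ((nodeOffset R m t i : ℝ) - (nodeOffset R m t' 0 : ℝ)) - (-v) := by ring
  rw [h2]
  have h3 := abs_sub_abs_le_abs_sub ((nodeOffset R m t i : ℝ) - (nodeOffset R m t' 0 : ℝ)) (-v)
  rw [abs_neg] at h3
  linarith

lemma finiteDiff_tensorWavelet_off_diag {Ψ : Fin 2 → ℝ → ℝ} {R : ℕ} (hR : 1 ≤ R)
    (hsupp : ∀ l y, (R : ℝ) ≤ |y| → Ψ l y = 0) {v : ℝ} (hv : |v| < R) {m : ℕ} (e : Fin d) (j : ℕ)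
    (κ : Fin d → Fin (2 ^ j)) (hκ : ∀ i, (κ i : ℕ) + blockLength d R m ≤ 2 ^ j)
    (k' : Fin d' → Fin (2 ^ j)) (a : Fin d' → ℝ) {t t' : Fin (testCount d m)} (htt' : t ≠ t') :
    finiteDiff (m + 1) (testStep R e j) (testPoint R m v e j κ t) (fun x =>
      tensorWavelet Ψ j (Fin.append (testPosition R m e j κ hR hκ t') k') (fun _ => 1)
        (Fin.append x a)) = 0 := by
  refine Finset.sum_eq_zero fun i hi => ?_
  beta_reduce
  rw [tensorWavelet_testNode_eq_zero hR hsupp hv e j κ hκ k' a t t'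
    (by simpa [Nat.lt_succ_iff] using hi) (fun h => htt' h.1), mul_zero]

/-- Only the node i = 0 meets the support. There every rescaled coordinate in x equals v, and the
hit condition bounds the factor in a from below. -/
lemma le_abs_finiteDiff_tensorWavelet_diag {Ψ : Fin 2 → ℝ → ℝ} {R : ℕ} (hR : 1 ≤ R)
    (hsupp : ∀ l y, (R : ℝ) ≤ |y| → Ψ l y = 0) {v : ℝ} (hv : |v| < R) {m : ℕ} (e : Fin d) (j : ℕ)
    (κ : Fin d → Fin (2 ^ j)) (hκ : ∀ i, (κ i : ℕ) + blockLength d R m ≤ 2 ^ j)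
    (k' : Fin d' → Fin (2 ^ j)) (a : Fin d' → ℝ) {τ : ℝ} (hτ : 0 ≤ τ)
    (ha : ∀ i, τ ≤ |Ψ 1 (2 ^ j * a i - ((k' i : ℕ) : ℝ))|) (t : Fin (testCount d m)) :
    |Ψ 1 v| ^ d * τ ^ d' ≤
      |finiteDiff (m + 1) (testStep R e j) (testPoint R m v e j κ t) (fun x =>
        tensorWavelet Ψ j (Fin.append (testPosition R m e j κ hR hκ t) k') (fun _ => 1)
          (Fin.append x a))| := by
  rw [finiteDiff, Finset.sum_eq_single 0]
  · have h1 : ∀ b, 2 ^ j * (testPoint R m v e j κ t + ((0 : ℕ) : ℝ) • testStep R e j) b -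
        ((testPosition R m e j κ hR hκ t b : ℕ) : ℝ) = v := by
      intro b
      rw [two_pow_mul_testNode]
      simp only [testPosition]
      push_cast
      ring
    rw [tensorWavelet_append]
    simp only [h1, Finset.prod_const, Finset.card_univ, Fintype.card_fin, Nat.choose_zero_right,
      Nat.cast_one, mul_one, abs_mul, abs_pow, abs_neg, abs_one, one_pow, one_mul,
      Finset.abs_prod]
    gcongr
    calc τ ^ d' = ∏ _i : Fin d', τ := by simp
      _ ≤ _ := Finset.prod_le_prod (fun _ _ => hτ) fun i _ => ha i
  · intro i hi hi0
    rw [tensorWavelet_testNode_eq_zero hR hsupp hv e j κ hκ k' a t t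
      (by simpa [Nat.lt_succ_iff] using hi) (fun h => hi0 h.2), mul_zero]
  · simp

lemma waveletPartialSum_add_probeCoeff {D : ℕ} (Ψ : Fin 2 → ℝ → ℝ) (s : ℝ) (γ : ℕ)
    (c : WaveletCoeff D) (ω : WaveletIndex D → unitInterval) (J : ℕ) (y : Fin D → ℝ) :
    waveletPartialSum Ψ (c + probeCoeff s γ ω) J y = waveletPartialSum Ψ c J y +
      ∑ i ∈ (Finset.range J).sigma (fun _ => Finset.univ), (ω i : ℝ) *
        (probeWeight s γ i.1 * tensorWavelet Ψ (i.1 + 1) i.2.1 i.2.2.1 y) := by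
  simp only [waveletPartialSum, Finset.sum_sigma, Fintype.sum_prod_type, Pi.add_apply, add_mul,
    Finset.sum_add_distrib, probeCoeff]
  congr 1
  refine Finset.sum_congr rfl fun n _ => Finset.sum_congr rfl fun k _ =>
    Finset.sum_congr rfl fun l _ => ?_
  ring

lemma testDiff_add_probeCoeff (Ψ : Fin 2 → ℝ → ℝ) (R m : ℕ) (v : ℝ) (e : Fin d) (j : ℕ)
    (κ : Fin d → Fin (2 ^ j)) (t : ℕ) (s : ℝ) (γ : ℕ) (c : WaveletCoeff (d + d'))
    (ω : WaveletIndex (d + d') → unitInterval) (J : ℕ) (a : Fin d' → ℝ) :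
    testDiff Ψ R m v e j κ t (c + probeCoeff s γ ω) J a = testDiff Ψ R m v e j κ t c J a +
      ∑ i ∈ (Finset.range J).sigma (fun _ => Finset.univ),
        (probeWeight s γ i.1 * finiteDiff (m + 1) (testStep R e j) (testPoint R m v e j κ t)
          (fun x => tensorWavelet Ψ (i.1 + 1) i.2.1 i.2.2.1 (Fin.append x a))) * (ω i : ℝ) := by
  simp only [testDiff, waveletPartialSum_add_probeCoeff]
  rw [finiteDiff_add, finiteDiff_sum]
  congr 1
  refine Finset.sum_congr rfl fun i _ => ?_
  have := finiteDiff_sum (m + 1) (testStep R e j) (testPoint R m v e j κ t) {()}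
    (fun _ => probeWeight s γ i.1)
    (fun _ x => tensorWavelet Ψ (i.1 + 1) i.2.1 i.2.2.1 (Fin.append x a))
  simp only [Finset.sum_singleton] at this
  rw [this, mul_comm]

/-- The law of the random coefficients of the probe. -/
noncomputable def probeLaw (D : ℕ) : Measure (WaveletIndex D → unitInterval) :=
  Measure.infinitePi fun _ => volume

instance (D : ℕ) : IsProbabilityMeasure (probeLaw D) := by
  unfold probeLaw; infer_instance

lemma probeLaw_testDiff_le {Ψ : Fin 2 → ℝ → ℝ} {R : ℕ} (hR : 1 ≤ R)
    (hsupp : ∀ l y, (R : ℝ) ≤ |y| → Ψ l y = 0) {v : ℝ} (hv : |v| < R) (hΨv : Ψ 1 v ≠ 0)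
    {m : ℕ} (e : Fin d) (s : ℝ) (γ n : ℕ) (κ : Fin d → Fin (2 ^ (n + 1)))
    (hκ : ∀ i, (κ i : ℕ) + blockLength d R m ≤ 2 ^ (n + 1)) {τ : ℝ} (hτ : 0 < τ)
    (c : WaveletCoeff (d + d')) {a : Fin d' → ℝ} (ha : a ∈ dyadicHitSet (Ψ 1) τ (n + 1))
    {J : ℕ} (hJ : n < J) :
    probeLaw (d + d') {ω | ∀ t : Fin (testCount d m),
      |testDiff Ψ R m v e (n + 1) κ t (c + probeCoeff s γ ω) J a| ≤ flatBound s m n} ≤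
      ENNReal.ofReal (2 * flatBound s m n / (probeWeight s γ n * (|Ψ 1 v| ^ d * τ ^ d'))) ^
        testCount d m := by
  obtain ⟨k', hk'⟩ := ha
  have hl : (fun _ : Fin (d + d') => (1 : Fin 2)) ≠ 0 := fun h => by
    have := congrFun h (Fin.castAdd d' e)
    simp at this
  -- The private coefficients all have type (1, …, 1) and share the position k' hit by a. All other
  -- scales, positions and types enter only through the frozen part.
  let idx : Fin (testCount d m) → WaveletIndex (d + d') := fun t =>
    ⟨n, Fin.append (testPosition R m e (n + 1) κ hR hκ t) k', ⟨fun _ => 1, hl⟩⟩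
  let θ : Fin (testCount d m) → WaveletIndex (d + d') → ℝ := fun t i =>
    probeWeight s γ i.1 * finiteDiff (m + 1) (testStep R e (n + 1))
      (testPoint R m v e (n + 1) κ t)
        (fun x => tensorWavelet Ψ (i.1 + 1) i.2.1 i.2.2.1 (Fin.append x a))
  have hinj : Function.Injective idx := by
    intro t t' h
    apply testPosition_injective e (n + 1) κ hR hκ
    have h1 := congrArg Prod.fst (eq_of_heq (Sigma.mk.inj h).2)
    funext i
    have := congrFun h1 (Fin.castAdd d' i)
    simpa only [Fin.append_left] using this
  have hmem : ∀ t, idx t ∈ (Finset.range J).sigma (fun _ => Finset.univ) := fun t =>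
    Finset.mem_sigma.2 ⟨Finset.mem_range.2 hJ, Finset.mem_univ _⟩
  have hoff : ∀ t t', t ≠ t' → θ t (idx t') = 0 := by
    intro t t' htt'
    have := finiteDiff_tensorWavelet_off_diag hR hsupp hv e (n + 1) κ hκ k' a htt'
    exact mul_eq_zero_of_right _ this
  have hA : 0 < probeWeight s γ n * (|Ψ 1 v| ^ d * τ ^ d') := by
    have := probeWeight_pos s γ n
    have := abs_pos.2 hΨv
    positivity
  have hdiag : ∀ t, probeWeight s γ n * (|Ψ 1 v| ^ d * τ ^ d') ≤ |θ t (idx t)| := by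
    intro t
    have h1 := le_abs_finiteDiff_tensorWavelet_diag hR hsupp hv e (n + 1) κ hκ k' a hτ.le hk' t
    have h2 := mul_le_mul_of_nonneg_left h1 (probeWeight_pos s γ n).le
    exact h2.trans_eq ((congrArg (· * _) (abs_of_pos (probeWeight_pos s γ n)).symm).trans
      (abs_mul _ _).symm)
  have key := infinitePi_abs_add_sum_le _ idx hinj hmem
    (fun t => testDiff Ψ R m v e (n + 1) κ t c J a) θ hoff hA (flatBound_pos s m n).le hdiag
  simp only [testDiff_add_probeCoeff]
  exact key

/-- The event is an increasing union of tail intersections, each contained in some `E J` with J ≥ N.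
-/
lemma measure_eventually_le {Ω : Type*} [MeasurableSpace Ω] (μ : Measure Ω) (E : ℕ → Set Ω)
    {b : ℝ≥0∞} {N : ℕ} (hE : ∀ J ≥ N, μ (E J) ≤ b) :
    μ {ω | ∃ J₀, ∀ J ≥ J₀, ω ∈ E J} ≤ b := by
  have h1 : {ω | ∃ J₀, ∀ J ≥ J₀, ω ∈ E J} = ⋃ J₀, ⋂ J ≥ J₀, E J := by
    ext ω; simp
  have hmono : Monotone (fun J₀ => ⋂ J ≥ J₀, E J) := by
    intro J₁ J₂ h
    exact Set.iInter₂_mono' fun J hJ => ⟨J, h.trans hJ, le_rfl⟩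
  rw [h1, hmono.measure_iUnion]
  refine iSup_le fun J₀ => (measure_mono ?_).trans (hE (max J₀ N) (le_max_right _ _))
  exact Set.iInter₂_subset _ (le_max_left _ _)

/-- Since `testCount` is (m+1)(d+1), the gain 2^(-j/(m+1)) per difference becomes 2^(-j(d+1)) in
total, one factor 2^(-j) better than the number of blocks. -/
lemma tendsto_block_count_mul_bound (d m : ℕ) (s : ℝ) (γ : ℕ) (A : ℝ) :
    Tendsto (fun n : ℕ => ((2 : ℝ) ^ (n + 1)) ^ d *
      (2 * flatBound s m n / (probeWeight s γ n * A)) ^ testCount d m) atTop (𝓝 0) := by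
  have h1 : Tendsto (fun n : ℕ => (2 / A) ^ testCount d m *
      (((n + 1 : ℕ) : ℝ) ^ (γ * testCount d m) / 2 ^ (n + 1))) atTop (𝓝 0) := by
    have := ((tendsto_pow_const_div_const_pow_of_one_lt (γ * testCount d m)
      (by norm_num : (1 : ℝ) < 2)).comp (tendsto_add_atTop_nat 1)).const_mul
        ((2 / A) ^ testCount d m)
    simpa using this
  refine h1.congr fun n => ?_
  have h2 : 2 * flatBound s m n / (probeWeight s γ n * A) =
      2 / A * (((n : ℝ) + 1) ^ γ * 2 ^ (-(1 / ((m : ℝ) + 1)) * ((n : ℝ) + 1))) := by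
    have h3 : flatBound s m n = 2 ^ (-(s * ((n : ℝ) + 1))) *
        2 ^ (-(1 / ((m : ℝ) + 1)) * ((n : ℝ) + 1)) := by
      rw [flatBound, ← Real.rpow_add (by norm_num)]
      ring_nf
    have h4 : (2 : ℝ) ^ (-(s * ((n : ℝ) + 1))) ≠ 0 := by positivity
    rw [h3, probeWeight]
    generalize (2 : ℝ) ^ (-(s * ((n : ℝ) + 1))) = u at *
    generalize (2 : ℝ) ^ (-(1 / ((m : ℝ) + 1)) * ((n : ℝ) + 1)) = w
    field_simp
  have h5 : ((2 : ℝ) ^ (-(1 / ((m : ℝ) + 1)) * ((n : ℝ) + 1))) ^ testCount d m =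
      (((2 : ℝ) ^ (n + 1)) ^ (d + 1))⁻¹ := by
    rw [← Real.rpow_natCast, ← Real.rpow_mul (by norm_num), ← pow_mul, ← Real.rpow_natCast,
      ← Real.rpow_neg (by norm_num), testCount]
    congr 1
    push_cast
    field_simp
  rw [h2, mul_pow, mul_pow, h5, pow_mul _ γ, pow_succ ((2 : ℝ) ^ (n + 1)) d]
  push_cast
  field_simp

/-- A frequently hit trace of a random perturbation is almost surely not flat. -/
lemma probeLaw_isFlatTrace_eq_zero {Ψ : Fin 2 → ℝ → ℝ} {R : ℕ} (hR : 1 ≤ R)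
    (hsupp : ∀ l y, (R : ℝ) ≤ |y| → Ψ l y = 0) {v : ℝ} (hv : |v| < R) (hΨv : Ψ 1 v ≠ 0)
    (m : ℕ) (e : Fin d) (s : ℝ) (γ : ℕ) {τ : ℝ} (hτ : 0 < τ)
    (c : WaveletCoeff (d + d')) {a : Fin d' → ℝ}
    (ha : ∃ᶠ j in atTop, a ∈ dyadicHitSet (Ψ 1) τ j) :
    probeLaw (d + d') {ω | IsFlatTrace Ψ s R v τ e m (c + probeCoeff s γ ω) a} = 0 := by
  set A : ℝ := |Ψ 1 v| ^ d * τ ^ d' with hA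
  have hA0 : 0 < A := by
    have := abs_pos.2 hΨv
    positivity
  unfold IsFlatTrace
  rw [Set.ofPred_exists, measure_iUnion_null_iff]
  intro n₀
  set S : ℕ → Set (WaveletIndex (d + d') → unitInterval) := fun n =>
    {ω | ∃ κ : Fin d → Fin (2 ^ (n + 1)), (∀ i, (κ i : ℕ) + blockLength d R m ≤ 2 ^ (n + 1)) ∧
      ∃ J₀ : ℕ, ∀ J ≥ J₀, ∀ t : Fin (testCount d m),
        |testDiff Ψ R m v e (n + 1) κ t (c + probeCoeff s γ ω) J a| ≤ flatBound s m n} with hS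
  have hSle : ∀ n, a ∈ dyadicHitSet (Ψ 1) τ (n + 1) → probeLaw (d + d') (S n) ≤
      ENNReal.ofReal (((2 : ℝ) ^ (n + 1)) ^ d *
        (2 * flatBound s m n / (probeWeight s γ n * A)) ^ testCount d m) := by
    intro n hn
    have hb : 0 ≤ 2 * flatBound s m n / (probeWeight s γ n * A) := by
      have := flatBound_pos s m n
      have := probeWeight_pos s γ n
      positivity
    simp only [hS]
    rw [Set.ofPred_exists]
    refine (measure_iUnion_fintype_le _ _).trans ?_
    calc _ ≤ ∑ _κ : Fin d → Fin (2 ^ (n + 1)),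
          ENNReal.ofReal (2 * flatBound s m n / (probeWeight s γ n * A)) ^ testCount d m := by
          refine Finset.sum_le_sum fun κ _ => ?_
          by_cases hκ : ∀ i, (κ i : ℕ) + blockLength d R m ≤ 2 ^ (n + 1)
          · simp only [hκ, implies_true, true_and]
            -- Partial sums of order J ≥ n + 1 are those containing the coefficients of scale n + 1.
            exact measure_eventually_le (probeLaw (d + d')) (fun J => {ω |
              ∀ t : Fin (testCount d m),
                |testDiff Ψ R m v e (n + 1) κ t (c + probeCoeff s γ ω) J a| ≤ flatBound s m n})
              (N := n + 1) fun J hJ =>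
                probeLaw_testDiff_le hR hsupp hv hΨv e s γ n κ hκ hτ c hn hJ
          · simp [hκ]
      _ = _ := by
          rw [Finset.sum_const, Finset.card_univ, Fintype.card_fun, Fintype.card_fin,
            Fintype.card_fin, nsmul_eq_mul, ENNReal.ofReal_mul (by positivity),
            ENNReal.ofReal_pow hb, ENNReal.ofReal_pow (by positivity),
            ENNReal.ofReal_pow (by norm_num)]
          norm_num
  have hlim := ENNReal.tendsto_ofReal (tendsto_block_count_mul_bound d m s γ A)
  rw [ENNReal.ofReal_zero] at hlim
  -- The flat event lies in `S n` for every hit scale n ≥ n₀, so bounds tending to 0 along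
  -- infinitely many n suffice; no summability is needed.
  refine le_antisymm (ge_of_tendsto_of_frequently hlim ?_) zero_le
  rw [frequently_atTop] at ha ⊢
  intro N
  obtain ⟨j, hj, hja⟩ := ha (max N n₀ + 1)
  obtain ⟨n, rfl⟩ : ∃ n, j = n + 1 := ⟨j - 1, by omega⟩
  refine ⟨n, by omega, (measure_mono ?_).trans (hSle n hja)⟩
  intro ω hω
  exact hω n (by omega) hja

end Probe

/-! ### Prevalence -/

lemma IsRegularWavelet.exists_support_bound {N : ℕ} {Ψ : Fin 2 → ℝ → ℝ}
    (hΨ : IsRegularWavelet N Ψ) : ∃ R : ℕ, 1 ≤ R ∧ ∀ l y, (R : ℝ) ≤ |y| → Ψ l y = 0 := by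
  have h := fun l => (hΨ.hasCompactSupport l).exists_pos_le_norm
  choose r _ hr using h
  obtain ⟨R, hR⟩ := exists_nat_ge (max (r 0) (r 1))
  refine ⟨R + 1, by omega, fun l y hy => hr l y ?_⟩
  have h0 : r l ≤ max (r 0) (r 1) := by
    fin_cases l
    · exact le_max_left _ _
    · exact le_max_right _ _
  rw [Real.norm_eq_abs]
  push_cast at hy
  linarith

lemma IsRegularWavelet.exists_abs_bound {N : ℕ} {Ψ : Fin 2 → ℝ → ℝ}
    (hΨ : IsRegularWavelet N Ψ) : ∃ B : ℝ, 0 ≤ B ∧ ∀ l y, |Ψ l y| ≤ B := by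
  have h := fun l => (hΨ.contDiff l).continuous.bounded_above_of_compact_support
    (hΨ.hasCompactSupport l)
  choose C hC using h
  refine ⟨max (C 0) (C 1), (norm_nonneg _).trans ((hC 0 0).trans (le_max_left _ _)),
    fun l y => (hC l y).trans ?_⟩
  fin_cases l
  · exact le_max_left _ _
  · exact le_max_right _ _

lemma IsRegularWavelet.exists_ne_zero {N : ℕ} {Ψ : Fin 2 → ℝ → ℝ}
    (hΨ : IsRegularWavelet N Ψ) : ∃ v, Ψ 1 v ≠ 0 := by
  by_contra! h
  exact hΨ.basis.ne_zero (0, 0) (ae_of_all _ fun x => h _)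

/-- The image of the compact space Ω is a compact set of full mass for the pushforward of `P`, so no
regularity of measures on E is needed. -/
lemma IsShy.of_continuous_probe {E Ω : Type} [AddCommGroup E] [TopologicalSpace E]
    [MeasurableSpace E] [BorelSpace E] [TopologicalSpace Ω] [CompactSpace Ω] [MeasurableSpace Ω]
    [OpensMeasurableSpace Ω] (hadd : ∀ x : E, Continuous fun y => y + x) (P : Measure Ω)
    [IsProbabilityMeasure P] {X : Ω → E} (hX : Continuous X) {A B : Set E} (hAB : A ⊆ B)
    (hB : MeasurableSet B) (hnull : ∀ x, ∀ᵐ ω ∂P, X ω + x ∉ B) : IsShy A := by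
  refine ⟨B, hAB, fun _ _ => hB.nullMeasurableSet, P.map X, ⟨Set.range X, isCompact_range hX,
    ?_, ?_⟩, fun x => ?_⟩
  · refine lt_of_lt_of_le ?_ (Measure.le_map_apply hX.measurable.aemeasurable _)
    simp
  · have := Measure.isProbabilityMeasure_map (μ := P) hX.measurable.aemeasurable
    exact measure_lt_top _ _
  · rw [Set.image_add_right, Measure.map_apply hX.measurable ((hadd (-x)).measurable hB)]
    exact measure_eq_zero_iff_ae_notMem.2 (hnull (-x))

theorem mainTheorem7 (d d' : ℕ) (hd : 1 ≤ d) (hd' : 1 ≤ d') (s p : ℝ) (q : ℝ≥0∞)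
    (hp : 0 < p) (hq : 0 < q) (hs : d / p < s)
    (N : ℕ) (hN : ⌊s⌋₊ + 1 ≤ N) (Ψ : Fin 2 → ℝ → ℝ) (hΨ : IsRegularWavelet N Ψ) :
    IsPrevalent {f : BesovSpace (d + d') s p q hp hq |
      ∀ᵐ a ∂(volume.restrict (Set.Icc (0 : Fin d' → ℝ) 1)),
        ∃ g : (Fin d → ℝ) → ℝ, IsTrace Ψ f.coeff a g ∧
          ∀ x ∈ Set.Icc (0 : Fin d → ℝ) 1,
            holderExponentWithin g (Set.Icc 0 1) x ≤ ENNReal.ofReal s} := by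
  have hcont : ∀ l, Continuous (Ψ l) := fun l => (hΨ.contDiff l).continuous
  obtain ⟨R, hR, hsupp⟩ := hΨ.exists_support_bound
  obtain ⟨M, hM0, hM⟩ := hΨ.exists_abs_bound
  obtain ⟨v, hv⟩ := hΨ.exists_ne_zero
  have hvR : |v| < R := by
    by_contra! h
    exact hv (hsupp 1 v h)
  have hv0 := abs_pos.2 hv
  set τ : ℝ := |Ψ 1 v| / 2 with hτ
  have hτ0 : 0 < τ := by positivity
  let e : Fin d := ⟨0, hd⟩
  obtain ⟨γ, X, hX, hXc⟩ := exists_probe_continuous (d + d') s p q hp hq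
  set ν := volume.restrict (Set.Icc (0 : Fin d' → ℝ) 1) with hν
  set Z : Set (BesovSpace (d + d') s p q hp hq × (Fin d' → ℝ)) :=
    {z | ∃ m, IsFlatTrace Ψ s R v τ e m z.1.coeff z.2} with hZ
  have hZm : MeasurableSet Z := by
    rw [hZ, Set.ofPred_exists]
    exact MeasurableSet.iUnion fun m => measurableSet_isFlatTrace hcont R v τ e m
  -- This B is Borel by Fubini, and it contains the exceptional set because traces exist at almost
  -- every a for every f.
  refine IsShy.of_continuous_probe BesovSpace.continuous_add_right (probeLaw (d + d')) hX
    (B := {f | ν (Prod.mk f ⁻¹' Z) ≠ 0}) ?_ ?_ ?_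
  · intro f hf hfB
    apply hf
    have h1 : ∀ᵐ a ∂ν, (f, a) ∉ Z := measure_eq_zero_iff_ae_notMem.1 hfB
    have h2 : ∀ᵐ a ∂ν, ∃ g : (Fin d → ℝ) → ℝ, IsTrace Ψ f.coeff a g :=
      ae_restrict_of_ae (ae_exists_isTrace hp hq hs hM0 hsupp hM f.coeff f.2)
    filter_upwards [h1, h2] with a ha ⟨g, hg⟩
    refine ⟨g, hg, fun x hx => iSup₂_le fun α hα => ?_⟩
    by_contra! hlt
    refine ha (isFlatTrace_of_pointwiseHolderWithin hR hvR τ e hg hx hα ?_)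
    rwa [← ENNReal.ofReal_coe_nnreal, ENNReal.ofReal_lt_ofReal_iff_of_nonneg] at hlt
    exact (div_nonneg (Nat.cast_nonneg d) hp.le).trans hs.le
  · exact (measurable_measure_prodMk_left hZm) (measurableSet_singleton (0 : ℝ≥0∞)).compl
  · intro f
    -- The probability estimate is made at a fixed; the almost-everywhere quantifiers are exchanged
    -- afterwards.
    have hcomm : ∀ᵐ a ∂ν, ∀ᵐ ω ∂(probeLaw (d + d')), (X ω + f, a) ∉ Z := by
      filter_upwards [ae_frequently_mem_dyadicHitSet (hcont 1) (half_lt_self hv0)] with a ha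
      have h1 : ∀ m, ∀ᵐ ω ∂(probeLaw (d + d')),
          ¬ IsFlatTrace Ψ s R v τ e m (f.coeff + probeCoeff s γ ω) a := fun m =>
        measure_eq_zero_iff_ae_notMem.1
          (probeLaw_isFlatTrace_eq_zero hR hsupp hvR hv m e s γ hτ0 f.coeff ha)
      filter_upwards [ae_all_iff.2 h1] with ω hω
      rintro ⟨m, hm⟩
      refine hω m ?_
      rw [← hXc, add_comm]
      exact hm
    have hm : MeasurableSet {z : (Fin d' → ℝ) × (WaveletIndex (d + d') → unitInterval) |
        (X z.2 + f, z.1) ∉ Z} := by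
      have h1 : Measurable fun z : (Fin d' → ℝ) × (WaveletIndex (d + d') → unitInterval) =>
          (X z.2 + f, z.1) :=
        (((BesovSpace.continuous_add_right f).comp hX).measurable.comp measurable_snd).prodMk
          measurable_fst
      exact (h1 hZm).compl
    filter_upwards [(Measure.ae_ae_comm hm).1 hcomm] with ω hω
    exact not_not.2 (measure_eq_zero_iff_ae_notMem.2 hω)
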